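/- Let $d\ge 1$ and let $D=\{x_1,\dots,x_n\}\subset\mathbb Z^d$ be a finite set with $n$ points. For $f:\mathbb Z^d\to\mathbb R$ put $\Delta f(x)=\frac1{2d}\sum_{y\sim x}(f(y)-f(x))$, and let $\Delta_D$ be the operator that maps a function $f$ on $D$, extended by $0$ outside of $D$, to the restriction of $\Delta f$ to $D$; it is viewed as an $n\times n$ matrix. For $k:D\to[0,\infty)$ let $I_k$ be the diagonal matrix with entries $k(x_1),\dots,k(x_n)$. Wilson's algorithm in $D$ runs as follows. Put $X^{(0)}=\emptyset$. For $j=1,\dots,n$, run a simple random walk on $\mathbb Z^d$ started from $x_j$, independent of the previous walks, until it first leaves $D\setminus X^{(j-1)}$, and let $X^{(j)}$ be the union of $X^{(j-1)}$ and the chronological loop-erasure of that stopped walk (if $x_j\in X^{(j-1)}$, then nothing happens and $X^{(j)}=X^{(j-1)}$). For $x\in D$, let $V(x)$ be the total number of times at which the walks of the algorithm are at $x$, where the time at which each walk is stopped is not counted. In the continuous-time version, one uses instead continuous-time simple random walks that jump at rate $1/(2d)$ along each edge (so that the holding times are independent exponential variables of mean $1$), and $W(x)$ is the total time that these walks spend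 at $x$ before they are stopped. The discrete Gaussian free field (GFF) in $D$ with Dirichlet boundary conditions is the centred Gaussian vector $(\Gamma(x))_{x\in D}$ whose density at $\gamma\in\mathbb R^D$ is a constant multiple of $\exp\bigl(-\frac12\cdot\frac1{2d}\sum_e|\nabla\gamma(e)|^2\bigr)$, where the sum is over all edges $e=\{x,y\}$ of $\mathbb Z^d$ with at least one end-point in $D$, $|\nabla\gamma(e)|=|\gamma(x)-\gamma(y)|$, and $\gamma=0$ outside of $D$. 1. For every $k:D\to[0,\infty)$, $$E\Bigl[\prod_{j=1}^n(1+k(x_j))^{-V(x_j)}\Bigr]=E\Bigl[\exp\Bigl(-\sum_{j=1}^n k(x_j)W(x_j)\Bigr)\Bigr]=\frac{\det(-\Delta_D)}{\det(-\Delta_D+I_k)}.$$ 2. If $\Gamma_1$ and $\Gamma_2$ are two independent GFFs in $D$ with Dirichlet boundary conditions, then the field $\bigl(\frac12\Gamma_1(x)^2+\frac12\Gamma_2(x)^2\bigr)_{x\in D}$ has the same law as $W=(W(x))_{x\in D}$. -/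

import Mathlib

open MeasureTheory ProbabilityTheory
open scoped ENNReal

namespace Wilson

/-- The lattice `ℤ^d`. -/
abbrev Lattice (d : ℕ) : Type := Fin d → ℤ

/-- The unit vector of `ℤ^d` in direction `i`; the `2d` neighbours of `x` are the points
`x + unitVec i` and `x - unitVec i`. -/
def unitVec {d : ℕ} (i : Fin d) : Lattice d := Pi.single i 1

/-! ### Discrete Laplacian -/

/-- The discrete Laplacian `Δ f (x) = (average of f over the 2d neighbours of x) - f x`. -/
noncomputable def laplacian {d : ℕ} (f : Lattice d → ℝ) (x : Lattice d) : ℝ :=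
  (2 * (d : ℝ))⁻¹ * (∑ i : Fin d, (f (x + unitVec i) + f (x - unitVec i))) - f x

/-- Extension of a function on `D` to a function on `ℤ^d` vanishing outside of `D`. -/
def extendZero {d : ℕ} (D : Finset (Lattice d)) (f : D → ℝ) (x : Lattice d) : ℝ :=
  if h : x ∈ D then f ⟨x, h⟩ else 0

/-- The Laplacian `Δ_D` with zero boundary conditions, as a linear operator on functions on `D`
(identified with the functions on `ℤ^d` that vanish outside of `D`). -/
noncomputable def dirichletLaplacian {d : ℕ} (D : Finset (Lattice d)) :
    (D → ℝ) →ₗ[ℝ] (D → ℝ) where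
  toFun f := fun x => laplacian (extendZero D f) x
  map_add' f g := by
    have h : ∀ y, extendZero D (f + g) y = extendZero D f y + extendZero D g y := by
      intro y
      unfold extendZero
      split_ifs <;> simp
    funext x
    simp only [laplacian, h, Pi.add_apply, Finset.sum_add_distrib]
    ring
  map_smul' c f := by
    have h : ∀ y, extendZero D (c • f) y = c * extendZero D f y := by
      intro y
      unfold extendZero
      split_ifs <;> simp
    funext x
    simp only [laplacian, h, Pi.smul_apply, smul_eq_mul, RingHom.id_apply, ← mul_add,
      ← Finset.mul_sum]
    ring

/-- The matrix `(Δ_D (x, y))_{x, y ∈ D}` of the operator `Δ_D`. -/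
noncomputable def laplacianMatrix {d : ℕ} (D : Finset (Lattice d)) : Matrix D D ℝ :=
  LinearMap.toMatrix' (dirichletLaplacian D)

/-! ### Discrete Gaussian free field -/

/-- The Dirichlet energy `∑_e |∇ F (e)|²` over the unoriented nearest-neighbour edges `e` of `ℤ^d`
with at least one end-point in `D`. Each edge in direction `i` is uniquely of the form
`{x, x + unitVec i}`, and meets `D` if and only if `x ∈ D` or `x ∈ D - unitVec i`. -/
noncomputable def dirichletEnergy {d : ℕ} (D : Finset (Lattice d)) (F : Lattice d → ℝ) : ℝ :=
  ∑ i : Fin d, ∑ x ∈ D ∪ D.image (fun y => y - unitVec i), (F (x + unitVec i) - F x) ^ 2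

/-- `Γ` is a discrete Gaussian free field in `D` with zero boundary conditions: its law on `ℝ^D`
has a density that is a constant multiple of `exp (- (1/2) * E_D(γ) / (2d))`. -/
structure IsGFF {d : ℕ} {Ω : Type*} [MeasurableSpace Ω] (P : Measure Ω) (D : Finset (Lattice d))
    (Γ : Ω → D → ℝ) : Prop where
  aemeasurable : AEMeasurable Γ P
  density : ∃ c : ℝ≥0∞, P.map Γ = (volume : Measure (D → ℝ)).withDensity (fun γ =>
    c * ENNReal.ofReal
      (Real.exp (-(1 / 2) * (dirichletEnergy D (extendZero D γ) / (2 * (d : ℝ))))))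

/-! ### Simple random walks in discrete and continuous time -/

/-- `Z` is a (discrete-time) simple random walk on `ℤ^d` started from `x`. -/
structure IsSimpleRandomWalk {d : ℕ} {Ω : Type*} [MeasurableSpace Ω] (P : Measure Ω)
    (x : Lattice d) (Z : ℕ → Ω → Lattice d) : Prop where
  measurable : ∀ r, Measurable (Z r)
  start : ∀ᵐ ω ∂P, Z 0 ω = x
  indep : iIndepFun (fun r ω => Z (r + 1) ω - Z r ω) P
  step_pos : ∀ r i, P {ω | Z (r + 1) ω - Z r ω = unitVec i} = (2 * (d : ℝ≥0∞))⁻¹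
  step_neg : ∀ r i, P {ω | Z (r + 1) ω - Z r ω = -unitVec i} = (2 * (d : ℝ≥0∞))⁻¹

/-- The continuous-time trajectory that visits successively `z 0, z 1, …` and stays for the time
`T m` at its `m`-th location: at time `t ≥ 0` it is at `z m`, where `m` is such that
`T 0 + ⋯ + T (m - 1) ≤ t < T 0 + ⋯ + T m`. -/
noncomputable def ctPath {d : ℕ} (z : ℕ → Lattice d) (T : ℕ → ℝ) (t : ℝ) : Lattice d :=
  z (sInf {m : ℕ | t < ∑ i ∈ Finset.range (m + 1), T i})

/-- `(Z, T)` are the successive locations and the successive holding times of a continuous-time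
simple random walk on `ℤ^d` started from `x`, which jumps at rate `1/(2d)` along each edge (hence at
total rate `1`): `Z` is a simple random walk, and the `T r` are independent exponential variables of
mean `1`, independent of `Z`. The walk itself is `t ↦ ctPath Z T t`. -/
structure IsCTSimpleRandomWalk {d : ℕ} {Ω : Type*} [MeasurableSpace Ω] (P : Measure Ω)
    (x : Lattice d) (Z : ℕ → Ω → Lattice d) (T : ℕ → Ω → ℝ) : Prop where
  skeleton : IsSimpleRandomWalk P x Z
  measurable : ∀ r, Measurable (T r)
  indep : iIndepFun T P
  law : ∀ r, P.map (T r) = expMeasure 1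
  indep_skeleton : IndepFun (fun ω r => Z r ω) (fun ω r => T r ω) P

/-! ### Loop-erasure and Wilson's algorithm -/

/-- The chronological loop-erasure of a finite path: keep its first point `a`, remove everything up
to (and including) the last visit of `a`, and continue with the remaining path. -/
def loopErasure {α : Type*} [DecidableEq α] : List α → List α
  | [] => []
  | a :: l => a :: loopErasure (l.rtakeWhile (fun b => decide (b ≠ a)))
termination_by l => l.length
decreasing_by
  have h : (l.rtakeWhile (fun b => decide (b ≠ a))).length ≤ l.length :=
    (List.rtakeWhile_suffix _ l).length_le
  simp only [List.length_cons]
  omega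

/-- The first time at which the path `z` is not in `A` (it is finite almost surely for a random walk
and a finite set `A`; the value is `0` if the path never leaves `A`). -/
noncomputable def exitTime {d : ℕ} (A : Finset (Lattice d)) (z : ℕ → Lattice d) : ℕ :=
  sInf {r | z r ∉ A}

/-- The first time at which the continuous-time path `y` is not in `A`. -/
noncomputable def ctExitTime {d : ℕ} (A : Finset (Lattice d)) (y : ℝ → Lattice d) : ℝ :=
  sInf {t | 0 ≤ t ∧ y t ∉ A}

/-- The set of sites of the part `X^(m)` of the tree constructed after the first `m` steps of Wilson's
algorithm in `D`, when the `j`-th step uses the walk `z j`: that walk is stopped when it leaves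
`D \ X^(j)`, and the sites of its loop-erasure are added. A walk that starts in `X^(j)` is stopped
immediately, and then nothing changes. -/
noncomputable def explored {d n : ℕ} (D : Finset (Lattice d)) (z : Fin n → ℕ → Lattice d) :
    ℕ → Finset (Lattice d)
  | 0 => ∅
  | m + 1 =>
    if h : m < n then
      explored D z m ∪
        (loopErasure ((List.range (exitTime (D \ explored D z m) (z ⟨m, h⟩) + 1)).map
          (z ⟨m, h⟩))).toFinset
    else explored D z m

/-- The discrete-time occupation field `V` of Wilson's algorithm: `V y` is the number of times spent
at `y` by all the walks, each one before (and not including) the time at which it is stopped. -/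
noncomputable def occupationV {d n : ℕ} (D : Finset (Lattice d)) (z : Fin n → ℕ → Lattice d)
    (y : D) : ℕ :=
  ∑ j : Fin n,
    ((Finset.range (exitTime (D \ explored D z j) (z j))).filter (fun r => z j r = y)).card

/-- The continuous-time occupation field `W` of Wilson's algorithm: `W y` is the total Lebesgue
measure of the time spent at `y` by all the continuous-time walks `ctPath (z j) (T j)`, each one up
to its exit time of the complement in `D` of what has been constructed before. The branches are
the loop-erasures of the sequences of sites that these walks visit. -/
noncomputable def occupationW {d n : ℕ} (D : Finset (Lattice d)) (z : Fin n → ℕ → Lattice d)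
    (T : Fin n → ℕ → ℝ) (y : D) : ℝ :=
  ∑ j : Fin n,
    (volume : Measure ℝ).real
      {t | 0 ≤ t ∧ t < ctExitTime (D \ explored D z j) (ctPath (z j) (T j)) ∧
        ctPath (z j) (T j) t = y}

end Wilson

/-! For A ⊆ D let R(A) = det(-Δ_A) / det(-Δ_A + I_κ) (`detRatio`), and give every counted visit to y
the weight 1/(1+κ(y)). The heart of the proof is that one step of Wilson's algorithm conserves R in
mean: if a walk from x is stopped on leaving A and γ is its loop-erasure, then E[weight · R(A \ γ)]
= R(A) (`pathSum_detRatio`). Iterating over the independent walks (`lintegral_prod_explored`) leads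
from R(D) at the start to R(∅) = 1 at the end, when all of D is explored. Hence the expected total
weight is R(D).

Conservation is an induction on A. Loop-erasure forgets the loops at the starting point, so a
decomposition at the first return to x (`pathSum_renewal`) gives a linear equation whose solution
carries the factor 1/(1-r), where r is the total weight of the excursions from x to x. After its
last visit to x the walk lives in A \ {x}, where the induction hypothesis applies. The factors fit
because, by Cramer's rule, passing from A \ {x} to A multiplies the determinant by (1+κ(x))(1-r)
(`det_killedMatrix_erase`). The induction carries a test function θ of the exit point, since the
walk in A \ {x} must be restricted not to exit at x.

Sums over paths become expectations in `IsSimpleRandomWalk.lintegral_stoppedPath`. In continuous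
time, an exponential holding time T of mean 1 has E[exp(-κT)] = 1/(1+κ), so integrating out the
holding times produces the same weights, and V and W lead to the same determinant formula.

For the free field, the factor exp(-∑ κ γ²/2) turns the quadratic form of -Δ_D into that of -Δ_D +
I_κ. One field therefore contributes the square root of R(D), and two independent ones contribute
R(D). Equal Laplace transforms on the positive orthant give equality in law (`ext_of_laplace`). -/

namespace Wilson

section

/-! ### Weighted sums over stopped paths -/

/-- The transition probabilities of the simple random walk. -/
noncomputable def stepProb {d : ℕ} (x y : Lattice d) : ℝ≥0∞ :=
  ∑ i : Fin d, ((if y = x + unitVec i then (2 * (d : ℝ≥0∞))⁻¹ else 0) +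
    if y = x - unitVec i then (2 * (d : ℝ≥0∞))⁻¹ else 0)

lemma tsum_stepProb_mul {d : ℕ} (x : Lattice d) (f : Lattice d → ℝ≥0∞) :
    ∑' y, stepProb x y * f y =
      (2 * (d : ℝ≥0∞))⁻¹ * ∑ i : Fin d, (f (x + unitVec i) + f (x - unitVec i)) := by
  simp only [stepProb, Finset.sum_mul, add_mul, ite_mul, zero_mul, Finset.mul_sum, mul_add]
  rw [Summable.tsum_finsetSum (fun _ _ => ENNReal.summable)]
  refine Finset.sum_congr rfl fun i _ => ?_
  rw [ENNReal.tsum_add, tsum_eq_single (x + unitVec i), tsum_eq_single (x - unitVec i)]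
  · simp
  · intro y hy; simp [hy]
  · intro y hy; simp [hy]

lemma tsum_stepProb_mul_le {d : ℕ} (x : Lattice d) {f : Lattice d → ℝ≥0∞} {c : ℝ≥0∞}
    (hf : ∀ y, f y ≤ c) : ∑' y, stepProb x y * f y ≤ c := by
  rw [tsum_stepProb_mul]
  calc (2 * (d : ℝ≥0∞))⁻¹ * ∑ i : Fin d, (f (x + unitVec i) + f (x - unitVec i))
      ≤ (2 * (d : ℝ≥0∞))⁻¹ * ∑ i : Fin d, (c + c) := by
        gcongr <;> exact hf _
    _ = ((2 * (d : ℝ≥0∞))⁻¹ * (2 * d)) * c := by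
        simp only [Finset.sum_const, Finset.card_univ, Fintype.card_fin, nsmul_eq_mul]; ring
    _ ≤ 1 * c := by gcongr; exact ENNReal.inv_mul_le_one _
    _ = c := one_mul c

/-- The weight of the first step of a walk at `x` that continues with the path `l`. -/
noncomputable def firstStep {d : ℕ} (w : Lattice d → ℝ≥0∞) (x : Lattice d) :
    List (Lattice d) → ℝ≥0∞
  | [] => 0
  | y :: _ => w x * stepProb x y

/-- The weight of a path that is stopped at its first exit from `A`, with a factor `w` for every
visit before the exit. It vanishes unless exactly the last point of the path is outside of `A`. -/
noncomputable def pathWeight {d : ℕ} (w : Lattice d → ℝ≥0∞) (A : Finset (Lattice d)) :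
    List (Lattice d) → ℝ≥0∞
  | [] => 0
  | x :: l => if x ∈ A then firstStep w x l * pathWeight w A l else if l = [] then 1 else 0

/-- The weighted sum of `φ` over the paths from `x` stopped at their exit from `A`. -/
noncomputable def pathSum {d : ℕ} (w : Lattice d → ℝ≥0∞) (A : Finset (Lattice d))
    (φ : List (Lattice d) → ℝ≥0∞) (x : Lattice d) : ℝ≥0∞ :=
  ∑' l, pathWeight w A (x :: l) * φ (x :: l)

lemma tsum_list_eq {α : Type*} (f : List α → ℝ≥0∞) :
    ∑' l, f l = f [] + ∑' a, ∑' l, f (a :: l) := by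
  let e : Unit ⊕ α × List α ≃ List α :=
    { toFun := Sum.elim (fun _ => []) (fun p => p.1 :: p.2)
      invFun := fun l => match l with
        | [] => Sum.inl ()
        | a :: l => Sum.inr (a, l)
      left_inv := by rintro (_ | _) <;> rfl
      right_inv := by rintro (_ | _) <;> rfl }
  rw [← e.tsum_eq f, Summable.tsum_sum ENNReal.summable ENNReal.summable]
  congr 1
  · simp [e]
  · rw [ENNReal.tsum_prod']; rfl

/-- A list containing `x` splits uniquely at its first occurrence of `x`. This is the combinatorial
form of decomposing a walk at its first visit to `x`. -/
lemma tsum_list_eq_of_mem {α : Type*} [DecidableEq α] (x : α) (f : List α → ℝ≥0∞) :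
    ∑' l, f l = ∑' l, (if x ∈ l then 0 else f l) +
      ∑' l₁, ∑' l₂, if x ∈ l₁ then 0 else f (l₁ ++ x :: l₂) := by
  have key : ∑' l, (if x ∈ l then f l else 0) =
      ∑' l₁, ∑' l₂, if x ∈ l₁ then 0 else f (l₁ ++ x :: l₂) := by
    let g : {l : List α // x ∉ l} × List α → List α := fun p => p.1 ++ x :: p.2
    have hg : Function.Injective g := by
      rintro ⟨⟨a, ha⟩, b⟩ ⟨⟨a', ha'⟩, b'⟩ h
      replace h : a ++ x :: b = a' ++ x :: b' := h
      have h' : a = a' ∧ b = b' := by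
        induction a generalizing a' with
        | nil =>
          cases a' with
          | nil => simpa using h
          | cons c a' => simp at h ha'; exact absurd h.1 ha'.1
        | cons c a ih =>
          cases a' with
          | nil => simp at h ha; exact absurd h.1.symm ha.1
          | cons c' a' =>
            simp only [List.mem_cons, not_or, List.cons_append, List.cons.injEq] at h ha ha'
            obtain ⟨rfl, rfl⟩ := ih ha.2 a' ha'.2 h.2
            exact ⟨by rw [h.1], rfl⟩
      simp [h'.1, h'.2]
    have hs : Function.support (fun l => if x ∈ l then f l else 0) ⊆ Set.range g := by
      intro l hl
      have hx : x ∈ l := by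
        by_contra h; simp [h] at hl
      obtain ⟨a, b, rfl, ha⟩ := List.eq_append_cons_of_mem hx
      exact ⟨⟨⟨a, ha⟩, b⟩, rfl⟩
    rw [← hg.tsum_eq hs, ENNReal.tsum_prod']
    have h2 : ∀ l₁ : {l : List α // x ∉ l}, ∑' l₂, (if x ∈ g (l₁, l₂) then f (g (l₁, l₂)) else 0) =
        (fun l₁ => ∑' l₂, if x ∈ l₁ then 0 else f (l₁ ++ x :: l₂)) l₁.1 := by
      intro l₁
      simp [g, l₁.2]
    rw [tsum_congr h2]
    refine Function.Injective.tsum_eq Subtype.val_injective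
      (f := fun l₁ => ∑' l₂, if x ∈ l₁ then 0 else f (l₁ ++ x :: l₂)) ?_
    intro l hl
    refine ⟨⟨l, fun h => ?_⟩, rfl⟩
    simp [h] at hl
  rw [← key, ← ENNReal.tsum_add]
  refine tsum_congr fun l => ?_
  split_ifs <;> simp

variable {d : ℕ} {w : Lattice d → ℝ≥0∞} {A : Finset (Lattice d)} {x : Lattice d}

lemma tsum_firstStep_mul (w : Lattice d → ℝ≥0∞) (x : Lattice d)
    (f : List (Lattice d) → ℝ≥0∞) :
    ∑' l, firstStep w x l * f l = w x * ∑' y, stepProb x y * ∑' l, f (y :: l) := by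
  rw [tsum_list_eq]
  simp only [firstStep, zero_mul, zero_add, mul_assoc, ENNReal.tsum_mul_left]

lemma pathSum_of_notMem (hx : x ∉ A) (φ : List (Lattice d) → ℝ≥0∞) :
    pathSum w A φ x = φ [x] := by
  rw [pathSum, tsum_eq_single []]
  · simp [pathWeight, hx]
  · intro l hl
    simp [pathWeight, hx, hl]

lemma pathSum_of_mem (hx : x ∈ A) (φ : List (Lattice d) → ℝ≥0∞) :
    pathSum w A φ x = w x * ∑' y, stepProb x y * pathSum w A (fun l => φ (x :: l)) y := by
  simp only [pathSum, pathWeight, hx, if_true, mul_assoc]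
  exact tsum_firstStep_mul w x _

/-- A path of nonzero weight is outside of `A` only at its end. It is used for `A.erase x`, where
visiting `x` means stopping there. -/
lemma getLast_of_pathWeight_ne_zero {l : List (Lattice d)} (h : pathWeight w A l ≠ 0) (hx : x ∉ A)
    (hxl : x ∈ l) : l.getLast? = some x := by
  induction l with
  | nil => simp at hxl
  | cons a l ih =>
    rw [pathWeight] at h
    by_cases ha : a ∈ A
    · rw [if_pos ha] at h
      have hl : l ≠ [] := by rintro rfl; simp [pathWeight] at h
      rw [List.getLast?_cons_of_ne_nil hl]
      refine ih (right_ne_zero_of_mul h) ?_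
      rcases List.mem_cons.1 hxl with rfl | h'
      · exact absurd ha hx
      · exact h'
    · rw [if_neg ha] at h
      have hl : l = [] := by
        by_contra hl; simp [hl] at h
      subst hl
      simp at hxl
      simp [hxl]

lemma pathWeight_erase_of_notMem {l : List (Lattice d)} (hxl : x ∉ l) :
    pathWeight w (A.erase x) l = pathWeight w A l := by
  induction l with
  | nil => rfl
  | cons a l ih =>
    simp only [List.mem_cons, not_or] at hxl
    simp [pathWeight, ih hxl.2, Ne.symm hxl.1]

/-- Weights multiply along a concatenation. Before its first visit to `x` the path avoids `x`, so
that its initial piece is a path stopped on leaving `A.erase x`. -/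
lemma pathWeight_append_cons {l₁ : List (Lattice d)} (hl : x ∉ l₁)
    (l₂ : List (Lattice d)) :
    pathWeight w A (l₁ ++ x :: l₂) =
      pathWeight w (A.erase x) (l₁ ++ [x]) * pathWeight w A (x :: l₂) := by
  induction l₁ with
  | nil => simp [pathWeight]
  | cons a l ih =>
    simp only [List.mem_cons, not_or] at hl
    have h : firstStep w a (l ++ x :: l₂) = firstStep w a (l ++ [x]) := by
      cases l <;> rfl
    have ih := ih hl.2
    simp only [List.cons_append]
    rw [pathWeight, pathWeight, ih, h]
    simp only [Finset.mem_erase, Ne.symm hl.1, ne_eq, not_false_eq_true, true_and]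
    by_cases h1 : a ∈ A
    · simp only [h1, if_true]
      ring
    · simp [h1]

/-! ### Excursions and renewal at the starting point -/

/-- The total weight of the excursions of the walk from `x` back to `x` inside `A`. -/
noncomputable def returnWeight (w : Lattice d → ℝ≥0∞) (A : Finset (Lattice d)) (x : Lattice d) :
    ℝ≥0∞ :=
  w x * ∑' y, stepProb x y *
    pathSum w (A.erase x) (fun l => if l.getLast? = some x then 1 else 0) y

lemma returnWeight_eq_tsum (w : Lattice d → ℝ≥0∞) (A : Finset (Lattice d)) (x : Lattice d) :
    returnWeight w A x = ∑' l, if x ∈ l then 0 else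
      firstStep w x (l ++ [x]) * pathWeight w (A.erase x) (l ++ [x]) := by
  have h := tsum_firstStep_mul w x
    (fun l => pathWeight w (A.erase x) l * if l.getLast? = some x then 1 else 0)
  rw [returnWeight]
  simp only [pathSum]
  rw [← h, tsum_list_eq_of_mem x]
  rw [ENNReal.tsum_eq_zero.2, zero_add]
  · refine tsum_congr fun l => ?_
    -- Since `x ∉ A.erase x`, a path that continues after its first visit to `x` has weight zero.
    rw [tsum_eq_single []]
    · simp
    · intro l₂ hl₂
      split_ifs with h1 h2
      · rfl
      · by_cases h0 : pathWeight w (A.erase x) (l ++ x :: l₂) = 0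
        · simp [h0]
        · exfalso
          clear h h2
          induction l with
          | nil => simp [pathWeight, hl₂] at h0
          | cons a l ih =>
            simp only [List.mem_cons, not_or] at h1
            refine ih h1.2 fun h => h0 ?_
            simp [pathWeight, h]
      · simp
  · intro l
    split_ifs with h1 h2
    · rfl
    · exact absurd (List.mem_of_getLast? h2) h1
    · simp

/-- Decomposition of the walk from `x` at its first return to `x`. -/
lemma pathSum_renewal (hx : x ∈ A) (φ φ' : List (Lattice d) → ℝ≥0∞)
    (h1 : ∀ l₁ l₂, φ (x :: (l₁ ++ x :: l₂)) = φ (x :: l₂))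
    (h2 : ∀ l, l ≠ [] → x ∉ l → φ (x :: l) = φ' l)
    (h3 : ∀ l, l.getLast? = some x → φ' l = 0) :
    pathSum w A φ x = returnWeight w A x * pathSum w A φ x +
      w x * ∑' y, stepProb x y * pathSum w (A.erase x) φ' y := by
  have hb := tsum_firstStep_mul w x (fun l => pathWeight w (A.erase x) l * φ' l)
  conv_lhs => rw [pathSum, tsum_list_eq_of_mem x]
  rw [add_comm]
  congr 1
  · rw [returnWeight_eq_tsum, ← ENNReal.tsum_mul_right]
    refine tsum_congr fun l => ?_
    rw [pathSum, ← ENNReal.tsum_mul_left]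
    refine tsum_congr fun l₂ => ?_
    split_ifs with h
    · simp
    · have hf : firstStep w x (l ++ x :: l₂) = firstStep w x (l ++ [x]) := by
        cases l <;> rfl
      rw [h1, pathWeight, if_pos hx, pathWeight_append_cons h, hf]
      ring
  · simp only [pathSum]
    rw [← hb]
    refine tsum_congr fun l => ?_
    split_ifs with h
    -- A path through `x` that is stopped on leaving `A.erase x` ends at `x`, where `φ'` vanishes:
    -- the final term counts no returning path.
    · by_cases h0 : pathWeight w (A.erase x) l = 0
      · simp [h0]
      · rw [h3 l (getLast_of_pathWeight_ne_zero h0 (Finset.notMem_erase x A) h)]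
        simp
    · rw [pathWeight, if_pos hx]
      by_cases hl : l = []
      · simp [hl, firstStep]
      · rw [h2 l hl h, pathWeight_erase_of_notMem h]
        ring

lemma pathSum_mono {φ ψ : List (Lattice d) → ℝ≥0∞} (h : ∀ l, φ l ≤ ψ l) :
    pathSum w A φ x ≤ pathSum w A ψ x :=
  ENNReal.tsum_le_tsum fun _ => by gcongr; exact h _

lemma pathSum_const_mul (c : ℝ≥0∞) (φ : List (Lattice d) → ℝ≥0∞) :
    pathSum w A (fun l => c * φ l) x = c * pathSum w A φ x := by
  simp only [pathSum, ← ENNReal.tsum_mul_left]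
  exact tsum_congr fun _ => by ring

/-- One step has total mass at most 1, so the bound propagates by induction on the length of the
path. Truncating the length provides the base case, and every finite partial sum is below some
truncated sum. -/
lemma pathSum_one_le (hw : ∀ y, w y ≤ 1) (x : Lattice d) : pathSum w A (fun _ => 1) x ≤ 1 := by
  have key : ∀ N x, ∑' l, (if l.length < N then pathWeight w A (x :: l) else 0) ≤ 1 := by
    intro N
    induction N with
    | zero => simp
    | succ N ih =>
      intro x
      by_cases hx : x ∈ A
      · calc ∑' l, (if l.length < N + 1 then pathWeight w A (x :: l) else 0)
            = ∑' l, firstStep w x l * (if l.length < N + 1 then pathWeight w A l else 0) := by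
              refine tsum_congr fun l => ?_
              split_ifs <;> simp [pathWeight, hx]
          _ = w x * ∑' y, stepProb x y *
              ∑' l, (if l.length < N then pathWeight w A (y :: l) else 0) := by
              rw [tsum_firstStep_mul]
              simp
          _ ≤ 1 * 1 := mul_le_mul' (hw x) (tsum_stepProb_mul_le x ih)
          _ = 1 := one_mul 1
      · rw [tsum_eq_single []]
        · simp [pathWeight, hx]
        · intro l hl; simp [pathWeight, hx, hl]
  rw [pathSum, ENNReal.tsum_eq_iSup_sum]
  refine iSup_le fun s => ?_
  refine le_trans ?_ (key (s.sup List.length + 1) x)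
  refine le_trans ?_ (ENNReal.sum_le_tsum s)
  refine Finset.sum_le_sum fun l hl => ?_
  rw [if_pos (Nat.lt_succ_of_le (Finset.le_sup (f := List.length) hl)), mul_one]

lemma pathSum_le {φ : List (Lattice d) → ℝ≥0∞} {c : ℝ≥0∞} (hw : ∀ y, w y ≤ 1)
    (hφ : ∀ l, φ l ≤ c) (x : Lattice d) : pathSum w A φ x ≤ c := by
  calc pathSum w A φ x ≤ pathSum w A (fun _ => c * 1) x := pathSum_mono (by simpa using hφ)
    _ = c * pathSum w A (fun _ => 1) x := pathSum_const_mul c _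
    _ ≤ c * 1 := by gcongr; exact pathSum_one_le hw x
    _ = c := mul_one c

end

section

/-! ### The killed Laplacian on subsets -/

variable {d : ℕ}

lemma add_unitVec_apply_self (i : Fin d) (x : Lattice d) : (x + unitVec i) i = x i + 1 := by
  simp [unitVec]

/-- The matrix of `-Δ + κ` with the rows outside of `A` replaced by those of the identity. -/
noncomputable def killedMatrix (D : Finset (Lattice d)) (κ : Lattice d → ℝ)
    (A : Finset (Lattice d)) : Matrix D D ℝ :=
  Matrix.of fun x => if (x : Lattice d) ∈ A then
    (-laplacianMatrix D + Matrix.diagonal (fun y : D => κ y)) x else Pi.single x 1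

variable {D : Finset (Lattice d)} {κ : Lattice d → ℝ}

lemma killedMatrix_self :
    killedMatrix D κ D = -laplacianMatrix D + Matrix.diagonal (fun y : D => κ y) := by
  ext x y
  simp [killedMatrix]

lemma killedMatrix_empty : killedMatrix D κ ∅ = 1 := by
  ext x y
  simp [killedMatrix, Matrix.one_apply, Pi.single_apply, eq_comm]

lemma mulVec_laplacianMatrix_add (f : D → ℝ) (x : D) :
    ((-laplacianMatrix D + Matrix.diagonal (fun y : D => κ y)).mulVec f) x =
      (1 + κ x) * f x - (2 * (d : ℝ))⁻¹ * ∑ i : Fin d,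
        (extendZero D f (x + unitVec i) + extendZero D f (x - unitVec i)) := by
  have h : (laplacianMatrix D).mulVec f = dirichletLaplacian D f :=
    LinearMap.toMatrix'_mulVec _ _
  rw [Matrix.add_mulVec, Matrix.neg_mulVec, h, Pi.add_apply, Pi.neg_apply, Matrix.mulVec_diagonal]
  simp only [dirichletLaplacian, LinearMap.coe_mk, AddHom.coe_mk, laplacian]
  have hx : extendZero D f x = f x := by simp [extendZero]
  rw [hx]
  ring

lemma killedMatrix_mulVec_of_mem {A : Finset (Lattice d)} (f : D → ℝ) {x : D}
    (hx : (x : Lattice d) ∈ A) :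
    ((killedMatrix D κ A).mulVec f) x =
      (1 + κ x) * f x - (2 * (d : ℝ))⁻¹ * ∑ i : Fin d,
        (extendZero D f (x + unitVec i) + extendZero D f (x - unitVec i)) := by
  rw [← mulVec_laplacianMatrix_add]
  simp [Matrix.mulVec, killedMatrix, hx]

lemma killedMatrix_mulVec_of_notMem {A : Finset (Lattice d)} (f : D → ℝ) {x : D}
    (hx : (x : Lattice d) ∉ A) :
    ((killedMatrix D κ A).mulVec f) x = f x := by
  simp [Matrix.mulVec, killedMatrix, hx]

/-- Maximum principle. -/
lemma eq_zero_of_killedMatrix_mulVec_eq_zero (hd : 1 ≤ d) (hκ : ∀ y, 0 ≤ κ y)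
    {A : Finset (Lattice d)} {f : D → ℝ} (hf : (killedMatrix D κ A).mulVec f = 0) : f = 0 := by
  by_contra hne
  obtain ⟨x₀, hx₀⟩ := Function.ne_iff.1 hne
  have hne' : (Finset.univ : Finset D).Nonempty := ⟨x₀, Finset.mem_univ _⟩
  obtain ⟨x₁, -, hx₁⟩ := Finset.exists_max_image Finset.univ (fun y : D => |f y|) hne'
  let i₀ : Fin d := ⟨0, hd⟩
  -- Among the maximisers of `|f|`, take one that is extreme in direction `i₀`. Its neighbour in
  -- that direction is outside of `D`, where the extension is zero, or is not a maximiser. This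
  -- strict inequality replaces a connectedness argument.
  obtain ⟨x, hxS, hx⟩ := Finset.exists_max_image
    (Finset.univ.filter fun y : D => |f y| = |f x₁|) (fun y : D => (y : Lattice d) i₀)
    ⟨x₁, by simp⟩
  have hxm : |f x| = |f x₁| := by simpa using hxS
  have hpos : 0 < |f x₁| := lt_of_lt_of_le (abs_pos.2 hx₀) (hx₁ x₀ (Finset.mem_univ _))
  have hle : ∀ y, |extendZero D f y| ≤ |f x₁| := by
    intro y
    unfold extendZero
    split_ifs with h
    · exact hx₁ _ (Finset.mem_univ _)
    · simp
  have hlt : |extendZero D f (x + unitVec i₀)| < |f x₁| := by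
    refine lt_of_le_of_ne (hle _) fun h => ?_
    unfold extendZero at h
    split_ifs at h with h'
    · have := hx ⟨_, h'⟩ (by simpa using h)
      simp only [add_unitVec_apply_self] at this
      omega
    · rw [abs_zero] at h
      exact hpos.ne h
  have hxf := congrFun hf x
  by_cases hxA : (x : Lattice d) ∈ A
  · rw [killedMatrix_mulVec_of_mem f hxA, Pi.zero_apply, sub_eq_zero] at hxf
    have hd' : (0 : ℝ) < 2 * (d : ℝ) := by
      have : (0 : ℝ) < d := by exact_mod_cast hd
      positivity
    have h1 : |(1 + κ x) * f x| = (1 + κ x) * |f x₁| := by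
      rw [abs_mul, hxm, abs_of_nonneg (by linarith [hκ x])]
    have h2 : |∑ i : Fin d,
        (extendZero D f (x + unitVec i) + extendZero D f (x - unitVec i))| <
        2 * (d : ℝ) * |f x₁| := by
      calc _ ≤ ∑ i : Fin d, (|extendZero D f (x + unitVec i)| + |extendZero D f (x - unitVec i)|) :=
            (Finset.abs_sum_le_sum_abs _ _).trans (Finset.sum_le_sum fun _ _ => abs_add_le _ _)
        _ < ∑ _i : Fin d, (|f x₁| + |f x₁|) :=
            Finset.sum_lt_sum (fun i _ => add_le_add (hle _) (hle _))
              ⟨i₀, Finset.mem_univ _, add_lt_add_of_lt_of_le hlt (hle _)⟩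
        _ = 2 * (d : ℝ) * |f x₁| := by simp; ring
    rw [hxf, abs_mul, abs_of_pos (inv_pos.2 hd')] at h1
    have h3 : (2 * (d : ℝ))⁻¹ * |∑ i : Fin d,
        (extendZero D f (x + unitVec i) + extendZero D f (x - unitVec i))| < |f x₁| := by
      rw [inv_mul_lt_iff₀ hd']
      exact h2
    nlinarith [hκ x]
  · rw [killedMatrix_mulVec_of_notMem f hxA, Pi.zero_apply] at hxf
    rw [hxf, abs_zero] at hxm
    exact hpos.ne hxm

lemma det_killedMatrix_ne_zero (hd : 1 ≤ d) (hκ : ∀ y, 0 ≤ κ y) (A : Finset (Lattice d)) :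
    (killedMatrix D κ A).det ≠ 0 := by
  intro h
  obtain ⟨v, hv, hv0⟩ := Matrix.exists_mulVec_eq_zero_iff.2 h
  exact hv (eq_zero_of_killedMatrix_mulVec_eq_zero hd hκ hv0)

/-! ### Killing weights and the Dirichlet problem for path sums -/

/-- The weight of a visit to a site for the walk with killing rate `κ`. -/
noncomputable def killWeight (κ : Lattice d → ℝ) (y : Lattice d) : ℝ≥0∞ :=
  ENNReal.ofReal (1 + κ y)⁻¹

lemma killWeight_le_one (hκ : ∀ y, 0 ≤ κ y) (y : Lattice d) : killWeight κ y ≤ 1 := by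
  rw [killWeight, ENNReal.ofReal_le_one]
  exact inv_le_one_of_one_le₀ (by linarith [hκ y])

lemma toReal_killWeight (hκ : ∀ y, 0 ≤ κ y) (y : Lattice d) :
    (killWeight κ y).toReal = (1 + κ y)⁻¹ :=
  ENNReal.toReal_ofReal (inv_nonneg.2 (by linarith [hκ y]))

lemma killWeight_zero : killWeight (0 : Lattice d → ℝ) = fun _ => 1 := by
  funext y; simp [killWeight]

lemma toReal_tsum_stepProb_mul (x : Lattice d) {f : Lattice d → ℝ≥0∞} (hf : ∀ y, f y ≠ ∞) :
    (∑' y, stepProb x y * f y).toReal =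
      (2 * (d : ℝ))⁻¹ * ∑ i : Fin d, ((f (x + unitVec i)).toReal + (f (x - unitVec i)).toReal) := by
  rw [tsum_stepProb_mul, ENNReal.toReal_mul, ENNReal.toReal_sum]
  · congr 1
    · simp
    · exact Finset.sum_congr rfl fun i _ => ENNReal.toReal_add (hf _) (hf _)
  · intro i _
    exact ENNReal.add_ne_top.2 ⟨hf _, hf _⟩

lemma pathSum_ne_top {A : Finset (Lattice d)} {w : Lattice d → ℝ≥0∞} (hw : ∀ y, w y ≤ 1)
    {φ : List (Lattice d) → ℝ≥0∞} {c : ℝ≥0∞} (hc : c ≠ ∞)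
    (hφ : ∀ l, φ l ≤ c) (x : Lattice d) : pathSum w A φ x ≠ ∞ :=
  ne_top_of_le_ne_top hc (pathSum_le hw hφ x)

lemma returnWeight_le_one {w : Lattice d → ℝ≥0∞} (hw : ∀ y, w y ≤ 1) (A : Finset (Lattice d))
    (x : Lattice d) : returnWeight w A x ≤ 1 := by
  have h := mul_le_mul' (hw x) (tsum_stepProb_mul_le x
    (pathSum_le (A := A.erase x) (c := 1) (φ := fun l => if l.getLast? = some x then 1 else 0) hw
      (fun l => by split_ifs <;> simp)))
  simpa [returnWeight] using h

/-- A path sum that depends on the exit point only solves the Dirichlet problem. -/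
lemma toReal_pathSum_of_mem (hκ : ∀ y, 0 ≤ κ y) {A : Finset (Lattice d)} {x : Lattice d}
    (hx : x ∈ A) {θ : Option (Lattice d) → ℝ≥0∞} (hθ : ∀ y, θ y ≤ 1) :
    (1 + κ x) * (pathSum (killWeight κ) A (fun l => θ l.getLast?) x).toReal =
      (2 * (d : ℝ))⁻¹ * ∑ i : Fin d,
        ((pathSum (killWeight κ) A (fun l => θ l.getLast?) (x + unitVec i)).toReal +
         (pathSum (killWeight κ) A (fun l => θ l.getLast?) (x - unitVec i)).toReal) := by
  have h : ∀ y, pathSum (killWeight κ) A (fun l => θ (x :: l).getLast?) y =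
      pathSum (killWeight κ) A (fun l => θ l.getLast?) y := by
    intro y
    refine tsum_congr fun l => ?_
    simp only [List.getLast?_cons_cons]
  have hpos : 1 + κ x ≠ 0 := by linarith [hκ x]
  rw [pathSum_of_mem hx, ENNReal.toReal_mul, toReal_killWeight hκ]
  simp only [h]
  rw [toReal_tsum_stepProb_mul x
    (pathSum_ne_top (killWeight_le_one hκ) ENNReal.one_ne_top fun l => hθ _)]
  field_simp

/-- The walk almost surely leaves a finite set. -/
lemma pathSum_one (hd : 1 ≤ d) (A : Finset (Lattice d)) (x : Lattice d) :
    pathSum (fun _ => 1) A (fun _ => 1) x = 1 := by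
  by_cases hx : x ∈ A
  swap
  · rw [pathSum_of_notMem hx]
  have hz : ∀ y, (0 : ℝ) ≤ (0 : Lattice d → ℝ) y := fun _ => le_rfl
  let F : Lattice d → ℝ≥0∞ := pathSum (fun _ => 1) A (fun _ => 1)
  have hF : ∀ y, F y ≠ ∞ := pathSum_ne_top (fun _ => le_rfl) ENNReal.one_ne_top fun _ => le_rfl
  have hstep : ∀ y ∈ A, (F y).toReal = (2 * (d : ℝ))⁻¹ * ∑ i : Fin d,
      ((F (y + unitVec i)).toReal + (F (y - unitVec i)).toReal) := by
    intro y hy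
    have := toReal_pathSum_of_mem hz hy (θ := fun _ => 1) (fun _ => le_rfl)
    simpa [killWeight_zero] using this
  have hd' : (d : ℝ) ≠ 0 := by positivity
  -- The escape probability `F` is harmonic in `A` and equal to 1 outside, so `1 - F` solves the
  -- homogeneous Dirichlet problem and vanishes by the maximum principle.
  have hv := eq_zero_of_killedMatrix_mulVec_eq_zero (D := A) (A := A) hd hz
    (f := fun y => 1 - (F y).toReal) (by
      funext y
      have hext : ∀ z, extendZero A (fun y : A => 1 - (F y).toReal) z = 1 - (F z).toReal := by
        intro z
        unfold extendZero
        split_ifs with hzA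
        · rfl
        · simp [F, pathSum_of_notMem hzA]
      rw [killedMatrix_mulVec_of_mem _ y.2]
      simp only [hext]
      rw [hstep y y.2]
      have : ∀ i : Fin d, (1 - (F (y + unitVec i)).toReal + (1 - (F (y - unitVec i)).toReal)) =
        2 - ((F (y + unitVec i)).toReal + (F (y - unitVec i)).toReal) := fun i => by ring
      simp only [this, Finset.sum_sub_distrib, Pi.zero_apply, Finset.sum_const, Finset.card_univ,
        Fintype.card_fin, nsmul_eq_mul]
      field_simp
      ring)
  have h1 : (F x).toReal = 1 := by
    have := congrFun hv ⟨x, hx⟩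
    simp only [Pi.zero_apply] at this
    linarith
  change F x = 1
  rw [← ENNReal.ofReal_toReal (hF x), h1, ENNReal.ofReal_one]

/-- Cramer's rule. Let `F` be the weight of reaching `x` before leaving `A`: it is 1 at `x`, 0
outside of `A`, and solves the Dirichlet equation on `A.erase x`. The matrix of `A` therefore maps
`F` to a multiple `s` of the indicator of `x`, where `s` comes from the equation at `x` and involves
the return weight. Applying the adjugate and reading coordinate `x` gives the determinant as `s`
times a cofactor. This cofactor is the determinant for `A.erase x`, since deleting a site amounts to
replacing its row by a unit vector. -/
lemma det_killedMatrix_erase (hκ : ∀ y, 0 ≤ κ y) {A : Finset (Lattice d)}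
    (hAD : A ⊆ D) {x : Lattice d} (hx : x ∈ A) :
    (killedMatrix D κ A).det =
      (1 + κ x) * (1 - (returnWeight (killWeight κ) A x).toReal) *
        (killedMatrix D κ (A.erase x)).det := by
  let θ : Option (Lattice d) → ℝ≥0∞ := fun o => if o = some x then 1 else 0
  have hθ : ∀ o, θ o ≤ 1 := fun o => by simp only [θ]; split_ifs <;> simp
  let F : Lattice d → ℝ≥0∞ := pathSum (killWeight κ) (A.erase x) (fun l => θ l.getLast?)
  have hF : ∀ y, F y ≠ ∞ :=
    pathSum_ne_top (killWeight_le_one hκ) ENNReal.one_ne_top fun _ => hθ _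
  have hFx : F x = 1 := by simp [F, θ, pathSum_of_notMem]
  have hFA : ∀ y ∉ A, F y = 0 := by
    intro y hy
    have hyx : y ≠ x := by rintro rfl; exact hy hx
    simp only [F]
    rw [pathSum_of_notMem (fun h => hy (Finset.mem_of_mem_erase h))]
    simp [θ, hyx]
  have hpos : 1 + κ x ≠ 0 := by linarith [hκ x]
  set s := (1 + κ x) * (1 - (returnWeight (killWeight κ) A x).toReal) with hs
  have hext : ∀ z, extendZero D (fun y : D => (F y).toReal) z = (F z).toReal := by
    intro z
    unfold extendZero
    split_ifs with hz
    · rfl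
    · rw [hFA z fun h => hz (hAD h), ENNReal.toReal_zero]
  let x' : D := ⟨x, hAD hx⟩
  have hN : (killedMatrix D κ A).mulVec (fun y : D => (F y).toReal) = s • Pi.single x' 1 := by
    funext y
    by_cases hyA : (y : Lattice d) ∈ A
    · rw [killedMatrix_mulVec_of_mem _ hyA]
      simp only [hext]
      by_cases hyx : y = x'
      · subst hyx
        simp only [x', hFx, Pi.smul_apply, Pi.single_eq_same, smul_eq_mul, mul_one, hs,
          returnWeight, ENNReal.toReal_one, ENNReal.toReal_mul, toReal_killWeight hκ]
        rw [toReal_tsum_stepProb_mul x hF]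
        field_simp
      · have : (y : Lattice d) ≠ x := fun h => hyx (Subtype.ext h)
        rw [toReal_pathSum_of_mem hκ (Finset.mem_erase.2 ⟨this, hyA⟩) hθ]
        simp [hyx, F]
    · have hyx : y ≠ x' := by rintro rfl; exact hyA hx
      rw [killedMatrix_mulVec_of_notMem _ hyA, hFA _ hyA]
      simp [hyx]
  have hupd : (killedMatrix D κ A).updateRow x' (Pi.single x' 1) =
      killedMatrix D κ (A.erase x) := by
    ext y z
    by_cases hyx : y = x'
    · subst hyx
      simp [killedMatrix, x']
    · have : (y : Lattice d) ≠ x := fun h => hyx (Subtype.ext h)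
      simp [killedMatrix, Matrix.updateRow_ne hyx, this]
  have h := congrArg (fun v => ((killedMatrix D κ A).adjugate.mulVec v) x') hN
  simp only [Matrix.mulVec_mulVec, Matrix.adjugate_mul, Matrix.mulVec_smul, Matrix.smul_mulVec,
    Matrix.one_mulVec, Pi.smul_apply, Matrix.mulVec_single_one, Matrix.col_apply, Matrix.adjugate_apply,
    smul_eq_mul, hupd] at h
  rw [← h]
  simp [x', hFx]

/-! ### Ratios of determinants -/

/-- The ratio `det(-Δ_A) / det(-Δ_A + I_κ)`. -/
noncomputable def detRatio (D : Finset (Lattice d)) (κ : Lattice d → ℝ)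
    (A : Finset (Lattice d)) : ℝ :=
  (killedMatrix D 0 A).det / (killedMatrix D κ A).det

/-- A return weight equal to 1 would make the determinant vanish by `det_killedMatrix_erase`,
against the maximum principle. -/
lemma returnWeight_toReal_lt_one (hd : 1 ≤ d) (hκ : ∀ y, 0 ≤ κ y) {A : Finset (Lattice d)}
    {x : Lattice d} (hx : x ∈ A) : (returnWeight (killWeight κ) A x).toReal < 1 := by
  refine lt_of_le_of_ne ?_ fun h => ?_
  · exact ENNReal.toReal_le_of_le_ofReal zero_le_one
      (by simpa using returnWeight_le_one (killWeight_le_one hκ) A x)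
  · have := det_killedMatrix_erase hκ (Finset.Subset.refl A) hx
    rw [h] at this
    simp at this
    exact det_killedMatrix_ne_zero hd hκ A this

/-- Quotient of the determinant recursions for killing rates 0 and `κ`. It has the same coefficients
as the renewal equations of the walk with and without killing. -/
lemma detRatio_erase (hd : 1 ≤ d) (hκ : ∀ y, 0 ≤ κ y) {A : Finset (Lattice d)}
    (hAD : A ⊆ D) {x : Lattice d} (hx : x ∈ A) :
    (1 + κ x) * (1 - (returnWeight (killWeight κ) A x).toReal) * detRatio D κ A =
      (1 - (returnWeight (fun _ => 1) A x).toReal) * detRatio D κ (A.erase x) := by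
  have h0 := det_killedMatrix_erase (κ := 0) (fun _ => le_rfl) hAD hx
  have h1 := det_killedMatrix_erase hκ hAD hx
  have hne := det_killedMatrix_ne_zero (D := D) hd hκ (A.erase x)
  have hne' := det_killedMatrix_ne_zero (D := D) hd hκ A
  rw [killWeight_zero] at h0
  simp only [Pi.zero_apply, add_zero, one_mul] at h0
  rw [h1] at hne'
  have hne'' := left_ne_zero_of_mul hne'
  have h2 : 1 - (returnWeight (killWeight κ) A x).toReal ≠ 0 := right_ne_zero_of_mul hne''
  have h3 : 1 + κ x ≠ 0 := left_ne_zero_of_mul hne''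
  rw [detRatio, detRatio, h0, h1]
  field_simp

lemma detRatio_empty : detRatio D κ ∅ = 1 := by
  simp [detRatio, killedMatrix_empty]

lemma detRatio_pos (hd : 1 ≤ d) (hκ : ∀ y, 0 ≤ κ y) {A : Finset (Lattice d)}
    (hAD : A ⊆ D) : 0 < detRatio D κ A := by
  induction A using Finset.induction_on with
  | empty => rw [detRatio_empty]; exact one_pos
  | insert x A hx ih =>
    have h := detRatio_erase hd hκ hAD (Finset.mem_insert_self x A)
    rw [Finset.erase_insert hx] at h
    have h1 := returnWeight_toReal_lt_one hd hκ (Finset.mem_insert_self x A)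
    have h2 := returnWeight_toReal_lt_one hd (κ := 0) (fun _ => le_rfl)
      (Finset.mem_insert_self x A)
    rw [killWeight_zero] at h2
    have h3 := ih ((Finset.subset_insert x A).trans hAD)
    have h4 : 0 < (1 + κ x) * (1 - (returnWeight (killWeight κ) (insert x A) x).toReal) :=
      mul_pos (by linarith [hκ x]) (by linarith)
    refine pos_of_mul_pos_right ?_ h4.le
    rw [h]
    exact mul_pos (by linarith) h3

/-! ### Loop-erasure -/

lemma loopErasure_cons {α : Type*} [DecidableEq α] (a : α) (l : List α) :
    loopErasure (a :: l) = a :: loopErasure (l.rtakeWhile (fun b => decide (b ≠ a))) := by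
  rw [loopErasure]

lemma loopErasure_cons_of_notMem {α : Type*} [DecidableEq α] {a : α} {l : List α} (h : a ∉ l) :
    loopErasure (a :: l) = a :: loopErasure l := by
  rw [loopErasure_cons, List.rtakeWhile_eq_self_iff.2]
  intro b hb
  simp only [ne_eq, decide_not, Bool.not_eq_true', decide_eq_false_iff_not]
  rintro rfl
  exact h hb

/-- Only the path after the last visit to `a` matters, so the first loop at `a` may be dropped. This
is the invariance needed for the renewal equation. -/
lemma loopErasure_cons_append_cons {α : Type*} [DecidableEq α] (a : α) (l₁ l₂ : List α) :
    loopErasure (a :: (l₁ ++ a :: l₂)) = loopErasure (a :: l₂) := by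
  rw [loopErasure_cons, loopErasure_cons]
  congr 2
  induction l₂ using List.reverseRecOn with
  | nil => rw [List.rtakeWhile_concat_neg]; simp; simp
  | append_singleton l b ih =>
    have : l₁ ++ a :: (l ++ [b]) = (l₁ ++ a :: l) ++ [b] := by simp
    rw [this, List.rtakeWhile_concat, List.rtakeWhile_concat, ih]

/-- Under the law tilted by the killing, the loop-erasure `γ` of the walk stopped at its exit from
`A` has its law tilted by the ratio of `detRatio A` and `detRatio (A \ γ)`. -/
lemma pathSum_detRatio_loopErasure (hd : 1 ≤ d) (hκ : ∀ y, 0 ≤ κ y)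
    {A : Finset (Lattice d)} (hAD : A ⊆ D) {θ : Option (Lattice d) → ℝ≥0∞} (hθ : ∀ y, θ y ≤ 1)
    (x : Lattice d) :
    pathSum (killWeight κ) A (fun l => θ l.getLast? *
      ENNReal.ofReal (detRatio D κ (A \ (loopErasure l).toFinset))) x =
    ENNReal.ofReal (detRatio D κ A) * pathSum (fun _ => 1) A (fun l => θ l.getLast?) x := by
  induction A using Finset.strongInduction generalizing x θ with
  | H A ih =>
  by_cases hx : x ∈ A
  swap
  · rw [pathSum_of_notMem hx, pathSum_of_notMem hx, loopErasure_cons_of_notMem (by simp)]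
    have : A \ (x :: loopErasure []).toFinset = A := by
      rw [loopErasure]; ext y; simp; rintro hy rfl; exact hx hy
    rw [this, mul_comm]
  -- In `A.erase x` the point `x` becomes a possible exit point; `θ'` excludes it, leaving the walks
  -- that never return to `x`.
  let θ' : Option (Lattice d) → ℝ≥0∞ := fun o => if o = some x then 0 else θ o
  have hθ' : ∀ o, θ' o ≤ 1 := fun o => by
    simp only [θ']
    split_ifs
    · exact zero_le_one
    · exact hθ o
  have hlast : ∀ l, l ≠ [] → x ∉ l → θ (x :: l).getLast? = θ' l.getLast? := by
    intro l hl hxl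
    rw [List.getLast?_cons_of_ne_nil hl]
    simp only [θ']
    rw [if_neg fun h => hxl (List.mem_of_getLast? h)]
  have hlast' : ∀ l₁ l₂ : List (Lattice d),
      (x :: (l₁ ++ x :: l₂)).getLast? = (x :: l₂).getLast? := by
    intro l₁ l₂
    rw [← List.cons_append, List.getLast?_append_of_ne_nil _ (by simp)]
  -- Only finitely many subsets of `A` can remain, so the test function is bounded and the path sums
  -- are finite. The renewal equations can then be solved over the reals.
  have hbound : ∃ c : ℝ≥0∞, c ≠ ∞ ∧
      ∀ l, ENNReal.ofReal (detRatio D κ (A \ (loopErasure l).toFinset)) ≤ c :=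
    ⟨∑ B ∈ A.powerset, ENNReal.ofReal (detRatio D κ B), by simp, fun l =>
      Finset.single_le_sum (f := fun B => ENNReal.ofReal (detRatio D κ B)) (by simp)
        (Finset.mem_powerset.2 Finset.sdiff_subset)⟩
  obtain ⟨c, hc, hbound⟩ := hbound
  have hu := pathSum_renewal (w := killWeight κ) hx
    (fun l => θ l.getLast? * ENNReal.ofReal (detRatio D κ (A \ (loopErasure l).toFinset)))
    (fun l => θ' l.getLast? *
      ENNReal.ofReal (detRatio D κ (A.erase x \ (loopErasure l).toFinset)))
    (fun l₁ l₂ => by simp only [hlast', loopErasure_cons_append_cons])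
    (fun l hl hxl => by
      rw [hlast l hl hxl, loopErasure_cons_of_notMem hxl]
      have : A \ (x :: loopErasure l).toFinset = A.erase x \ (loopErasure l).toFinset := by
        ext y
        simp only [List.toFinset_cons, Finset.mem_sdiff, Finset.mem_insert, Finset.mem_erase]
        tauto
      rw [this])
    (fun l hl => by simp [θ', hl])
  have hh := pathSum_renewal (w := fun _ => 1) hx
    (fun l => θ l.getLast?) (fun l => θ' l.getLast?)
    (fun l₁ l₂ => by simp only [hlast'])
    (fun l hl hxl => hlast l hl hxl)
    (fun l hl => by simp [θ', hl])
  have hsub : A.erase x ⊆ D := (Finset.erase_subset x A).trans hAD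
  simp only [ih _ (Finset.erase_ssubset hx) hsub hθ'] at hu
  have hufin := pathSum_ne_top (A := A) (killWeight_le_one hκ) hc
    (φ := fun l => θ l.getLast? * ENNReal.ofReal (detRatio D κ (A \ (loopErasure l).toFinset)))
    (fun l => (mul_le_mul' (hθ _) (hbound l)).trans_eq (one_mul c)) x
  have hhfin := pathSum_ne_top (A := A) (w := fun _ => 1) (fun _ => le_rfl) ENNReal.one_ne_top
    (φ := fun l => θ l.getLast?) (fun l => hθ _) x
  set u := pathSum (killWeight κ) A (fun l => θ l.getLast? *
      ENNReal.ofReal (detRatio D κ (A \ (loopErasure l).toFinset))) x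
  set h := pathSum (fun _ => 1) A (fun l => θ l.getLast?) x
  have ha : ∑' y, stepProb x y * (ENNReal.ofReal (detRatio D κ (A.erase x)) *
        pathSum (fun _ => 1) (A.erase x) (fun l => θ' l.getLast?) y) =
      ENNReal.ofReal (detRatio D κ (A.erase x)) *
        ∑' y, stepProb x y * pathSum (fun _ => 1) (A.erase x) (fun l => θ' l.getLast?) y := by
    rw [← ENNReal.tsum_mul_left]
    exact tsum_congr fun y => by ring
  rw [ha] at hu
  have hafin : ∑' y, stepProb x y *
      pathSum (fun _ => 1) (A.erase x) (fun l => θ' l.getLast?) y ≠ ∞ :=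
    ne_top_of_le_ne_top ENNReal.one_ne_top
      (tsum_stepProb_mul_le x (pathSum_le (fun _ => le_rfl) fun l => hθ' _))
  set a := ∑' y, stepProb x y * pathSum (fun _ => 1) (A.erase x) (fun l => θ' l.getLast?) y
  have hr1 : returnWeight (killWeight κ) A x ≠ ∞ :=
    ne_top_of_le_ne_top ENNReal.one_ne_top (returnWeight_le_one (killWeight_le_one hκ) A x)
  have hr0 : returnWeight (fun _ => 1) A x ≠ ∞ :=
    ne_top_of_le_ne_top ENNReal.one_ne_top (returnWeight_le_one (fun _ => le_rfl) A x)
  have hkw : killWeight κ x ≠ ∞ := ENNReal.ofReal_ne_top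
  have huR := congrArg ENNReal.toReal hu
  have hhR := congrArg ENNReal.toReal hh
  rw [ENNReal.toReal_add (ENNReal.mul_ne_top hr1 hufin)
    (ENNReal.mul_ne_top hkw (ENNReal.mul_ne_top ENNReal.ofReal_ne_top hafin))] at huR
  rw [ENNReal.toReal_add (ENNReal.mul_ne_top hr0 hhfin)
    (ENNReal.mul_ne_top ENNReal.one_ne_top hafin)] at hhR
  simp only [ENNReal.toReal_mul, toReal_killWeight hκ, one_mul,
    ENNReal.toReal_ofReal (detRatio_pos hd hκ hsub).le] at huR hhR
  rw [← ENNReal.toReal_eq_toReal_iff' hufin (ENNReal.mul_ne_top ENNReal.ofReal_ne_top hhfin),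
    ENNReal.toReal_mul, ENNReal.toReal_ofReal (detRatio_pos hd hκ hAD).le]
  have hrec := detRatio_erase hd hκ hAD hx
  have hlt := returnWeight_toReal_lt_one hd hκ hx
  have hpos : 0 < 1 + κ x := by linarith [hκ x]
  have hne : (1 + κ x) * (1 - (returnWeight (killWeight κ) A x).toReal) ≠ 0 :=
    (mul_pos hpos (by linarith)).ne'
  -- The renewal equations read (1-r)u = (1+κ)⁻¹ R(A \ {x}) a and (1-r₀)h = a, with r and r₀ the
  -- return weights with and without killing. Together with `detRatio_erase` they give u = R(A) h.
  apply mul_left_cancel₀ hne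
  have e1 : (1 + κ x) * (1 - (returnWeight (killWeight κ) A x).toReal) * u.toReal =
      detRatio D κ (A.erase x) * a.toReal := by
    have : (1 - (returnWeight (killWeight κ) A x).toReal) * u.toReal =
      (1 + κ x)⁻¹ * (detRatio D κ (A.erase x) * a.toReal) := by linarith
    rw [mul_assoc, this, ← mul_assoc, mul_inv_cancel₀ hpos.ne', one_mul]
  rw [e1, ← mul_assoc, hrec]
  have e2 : a.toReal = (1 - (returnWeight (fun _ => 1) A x).toReal) * h.toReal := by linarith
  rw [e2]
  ring

lemma pathSum_detRatio (hd : 1 ≤ d) (hκ : ∀ y, 0 ≤ κ y)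
    {A : Finset (Lattice d)} (hAD : A ⊆ D) (x : Lattice d) :
    pathSum (killWeight κ) A
      (fun l => ENNReal.ofReal (detRatio D κ (A \ (loopErasure l).toFinset))) x =
    ENNReal.ofReal (detRatio D κ A) := by
  have h := pathSum_detRatio_loopErasure hd hκ hAD (θ := fun _ => 1) (fun _ => le_rfl) x
  simpa [pathSum_one hd] using h

end

section

/-! ### The law of the stopped walk -/

variable {d : ℕ}

/-- The path `z` up to (and including) its exit from `A`. -/
noncomputable def stoppedPath (A : Finset (Lattice d)) (z : ℕ → Lattice d) : List (Lattice d) :=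
  (List.range (exitTime A z + 1)).map z

lemma length_stoppedPath (A : Finset (Lattice d)) (z : ℕ → Lattice d) :
    (stoppedPath A z).length = exitTime A z + 1 := by
  simp [stoppedPath]

lemma stoppedPath_getD (A : Finset (Lattice d)) (z : ℕ → Lattice d) {i : ℕ}
    (hi : i ≤ exitTime A z) : (stoppedPath A z).getD i 0 = z i := by
  rw [List.getD_eq_getElem _ _ (by rw [length_stoppedPath]; omega)]
  simp [stoppedPath]

lemma stoppedPath_eq_iff (A : Finset (Lattice d)) (z : ℕ → Lattice d) (l : List (Lattice d)) :
    stoppedPath A z = l ↔ exitTime A z + 1 = l.length ∧ ∀ i < l.length, z i = l.getD i 0 := by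
  constructor
  · rintro rfl
    rw [length_stoppedPath]
    exact ⟨rfl, fun i hi => (stoppedPath_getD A z (by omega)).symm⟩
  · rintro ⟨h1, h2⟩
    refine List.ext_getElem (by rw [length_stoppedPath, h1]) fun i hi hi' => ?_
    rw [← List.getD_eq_getElem _ 0 hi', ← h2 i hi']
    simp [stoppedPath]

lemma exitTime_eq {A : Finset (Lattice d)} {z : ℕ → Lattice d} {m : ℕ} (h : ∀ i < m, z i ∈ A)
    (hm : z m ∉ A) : exitTime A z = m := by
  refine le_antisymm (Nat.sInf_le hm) ?_
  by_contra hlt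
  push Not at hlt
  have hne : {r | z r ∉ A}.Nonempty := ⟨m, hm⟩
  exact Nat.sInf_mem hne (h _ hlt)

lemma mem_of_lt_exitTime {A : Finset (Lattice d)} {z : ℕ → Lattice d} {r : ℕ}
    (h : r < exitTime A z) : z r ∈ A := by
  by_contra hr
  exact absurd (Nat.sInf_le (s := {r | z r ∉ A}) hr) (not_le.2 h)

lemma exists_length_of_pathWeight_ne_zero {w : Lattice d → ℝ≥0∞} {A : Finset (Lattice d)}
    {l : List (Lattice d)} (h : pathWeight w A l ≠ 0) :
    ∃ m, l.length = m + 1 ∧ (∀ i < m, l.getD i 0 ∈ A) ∧ l.getD m 0 ∉ A := by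
  induction l with
  | nil => exact absurd rfl h
  | cons a l ih =>
    rw [pathWeight] at h
    split_ifs at h with ha hl
    · obtain ⟨m, h1, h2, h3⟩ := ih (right_ne_zero_of_mul h)
      refine ⟨m + 1, by simp [h1], fun i hi => ?_, by simpa using h3⟩
      cases i with
      | zero => simpa using ha
      | succ i => simpa using h2 i (by omega)
    · subst hl
      exact ⟨0, rfl, by simp, by simpa using ha⟩
    · exact absurd rfl h

lemma stoppedPath_eq_of_pathWeight_ne_zero {w : Lattice d → ℝ≥0∞} {A : Finset (Lattice d)}
    {l : List (Lattice d)} (h : pathWeight w A l ≠ 0) {z : ℕ → Lattice d}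
    (hz : ∀ i < l.length, z i = l.getD i 0) : stoppedPath A z = l := by
  obtain ⟨m, h1, h2, h3⟩ := exists_length_of_pathWeight_ne_zero h
  refine (stoppedPath_eq_iff A z l).2 ⟨?_, hz⟩
  rw [h1, exitTime_eq (m := m)]
  · intro i hi
    rw [hz i (by omega)]
    exact h2 i hi
  · rw [hz m (by omega)]
    exact h3

lemma pathWeight_one_le (A : Finset (Lattice d)) (x : Lattice d) (l : List (Lattice d)) :
    pathWeight (fun _ => 1) A (x :: l) ≤ ∏ i ∈ Finset.range l.length,
      stepProb ((x :: l).getD i 0) ((x :: l).getD (i + 1) 0) := by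
  induction l generalizing x with
  | nil =>
    simp only [pathWeight, firstStep]
    split_ifs <;> simp
  | cons y l ih =>
    rw [pathWeight]
    split_ifs with h1 h2
    · rw [List.length_cons, Finset.prod_range_succ', mul_comm]
      refine mul_le_mul' ?_ ?_
      · simpa using ih y
      · simp [firstStep]
    · simp at h2
    · simp

/-- Killing is a change of measure: it multiplies the probability of the path by one factor per
visit. `dropLast` is there because the exit point is not counted. -/
lemma pathWeight_eq_mul_prod (w : Lattice d → ℝ≥0∞) (A : Finset (Lattice d))
    (l : List (Lattice d)) :
    pathWeight w A l = pathWeight (fun _ => 1) A l * (l.dropLast.map w).prod := by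
  induction l with
  | nil => simp [pathWeight]
  | cons a l ih =>
    rw [pathWeight, pathWeight, ih]
    cases l with
    | nil => simp [firstStep]
    | cons b l =>
      simp only [firstStep, one_mul, List.dropLast_cons_cons, List.map_cons, List.prod_cons,
        reduceCtorEq, if_false]
      split_ifs
      · ring
      · simp

lemma prod_dropLast_stoppedPath (w : Lattice d → ℝ≥0∞) (A : Finset (Lattice d))
    (z : ℕ → Lattice d) :
    ((stoppedPath A z).dropLast.map w).prod = ∏ r ∈ Finset.range (exitTime A z), w (z r) := by
  rw [stoppedPath, List.range_succ, List.map_append, List.map_singleton, List.dropLast_concat,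
    List.map_map, Finset.prod_range]
  rw [← List.prod_ofFn, List.ofFn_eq_map, ← List.map_coe_finRange_eq_range, List.map_map]
  rfl

/-! ### Measurability of the stopped path -/

lemma measurable_exitTime (A : Finset (Lattice d)) :
    Measurable (fun z : ℕ → Lattice d => exitTime A z) := by
  classical
  -- The second alternative makes the search succeed at 0 on paths that never leave `A`, in
  -- agreement with the infimum of the empty set.
  have hex : ∀ z : ℕ → Lattice d, ∃ r, z r ∉ A ∨ ∀ s, z s ∈ A := by
    intro z
    by_cases h : ∃ r, z r ∉ A
    · exact h.imp fun _ => Or.inl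
    · push Not at h
      exact ⟨0, Or.inr h⟩
  have heq : (fun z : ℕ → Lattice d => exitTime A z) = fun z => Nat.find (hex z) := by
    funext z
    by_cases h : ∃ r, z r ∉ A
    · have hs : ¬ ∀ s, z s ∈ A := by push Not; exact h
      refine exitTime_eq (fun i hi => ?_) ?_
      · have := Nat.find_min (hex z) hi
        push Not at this
        exact this.1
      · exact (Nat.find_spec (hex z)).resolve_right hs
    · push Not at h
      have h0 : Nat.find (hex z) = 0 := (Nat.find_eq_zero _).2 (Or.inr h)
      rw [h0, exitTime]
      have : {r | z r ∉ A} = ∅ := by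
        ext r; simp [h r]
      rw [this, Nat.sInf_empty]
  rw [heq]
  refine measurable_find hex fun k => ?_
  have hm : ∀ s, MeasurableSet {z : ℕ → Lattice d | z s ∈ A} := fun s =>
    (measurable_pi_apply s) A.measurableSet
  have : {z : ℕ → Lattice d | z k ∉ A ∨ ∀ s, z s ∈ A} =
      {z | z k ∈ A}ᶜ ∪ ⋂ s, {z | z s ∈ A} := by
    ext z; simp
  rw [this]
  exact (hm k).compl.union (MeasurableSet.iInter hm)

lemma measurableSet_stoppedPath_eq (A : Finset (Lattice d)) (l : List (Lattice d)) :
    MeasurableSet {z : ℕ → Lattice d | stoppedPath A z = l} := by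
  have : {z : ℕ → Lattice d | stoppedPath A z = l} = exitTime A ⁻¹' {m | m + 1 = l.length} ∩
      ⋂ i, ⋂ (_ : i < l.length), (fun z : ℕ → Lattice d => z i) ⁻¹' {l.getD i 0} := by
    ext z; simp [stoppedPath_eq_iff]
  rw [this]
  refine MeasurableSet.inter ?_ (MeasurableSet.iInter fun i => MeasurableSet.iInter fun _ => ?_)
  · exact (measurable_exitTime A) (MeasurableSet.of_discrete (s := {m | m + 1 = l.length}))
  · exact (measurable_pi_apply i) (MeasurableSet.singleton (l.getD i 0))

lemma measurable_stoppedPath {β : Type*} [MeasurableSpace β] (A : Finset (Lattice d))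
    (F : List (Lattice d) → β) : Measurable (fun z : ℕ → Lattice d => F (stoppedPath A z)) := by
  intro s _
  have : (fun z : ℕ → Lattice d => F (stoppedPath A z)) ⁻¹' s =
      ⋃ l ∈ F ⁻¹' s, {z | stoppedPath A z = l} := by
    ext z; simp
  rw [this]
  exact MeasurableSet.biUnion (Set.to_countable _) fun l _ => measurableSet_stoppedPath_eq A l

lemma unitVec_injective : Function.Injective (unitVec : Fin d → Lattice d) := by
  intro i j h
  by_contra hij
  have := congrFun h i
  simp [unitVec, hij] at this

lemma unitVec_ne_neg_unitVec (i j : Fin d) : (unitVec i : Lattice d) ≠ -unitVec j := by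
  intro h
  have := congrFun h i
  by_cases hij : i = j
  · subst hij; simp [unitVec] at this
  · simp [unitVec, hij] at this

lemma stepProb_add_unitVec (x : Lattice d) (i : Fin d) :
    stepProb x (x + unitVec i) = (2 * (d : ℝ≥0∞))⁻¹ := by
  rw [stepProb, Finset.sum_eq_single i]
  · simp [sub_eq_add_neg, unitVec_ne_neg_unitVec]
  · intro j _ hj
    simp [sub_eq_add_neg, unitVec_ne_neg_unitVec, unitVec_injective.eq_iff, Ne.symm hj]
  · simp

lemma stepProb_sub_unitVec (x : Lattice d) (i : Fin d) :
    stepProb x (x - unitVec i) = (2 * (d : ℝ≥0∞))⁻¹ := by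
  rw [stepProb, Finset.sum_eq_single i]
  · simp [sub_eq_add_neg, (unitVec_ne_neg_unitVec _ _).symm]
  · intro j _ hj
    simp [sub_eq_add_neg, (unitVec_ne_neg_unitVec _ _).symm, unitVec_injective.eq_iff, Ne.symm hj]
  · simp

/-! ### Path probabilities of the simple random walk -/

section Walk

variable {Ω : Type*} [MeasurableSpace Ω] {P : Measure Ω} {x : Lattice d} {Z : ℕ → Ω → Lattice d}

lemma IsSimpleRandomWalk.stepProb_le (h : IsSimpleRandomWalk P x Z) (r : ℕ) (y z : Lattice d) :
    stepProb y z ≤ P {ω | Z (r + 1) ω - Z r ω = z - y} := by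
  by_cases h1 : ∃ i, z = y + unitVec i
  · obtain ⟨i, rfl⟩ := h1
    rw [stepProb_add_unitVec, add_sub_cancel_left, h.step_pos]
  by_cases h2 : ∃ i, z = y - unitVec i
  · obtain ⟨i, rfl⟩ := h2
    rw [stepProb_sub_unitVec, sub_sub_cancel_left, h.step_neg]
  push Not at h1 h2
  simp [stepProb, h1, h2]

/-- Prescribing the increments along `l` forces the stopped path, and independence gives the
probability of these increments. A lower bound is enough, because both sides will turn out to have
total mass 1. -/
lemma IsSimpleRandomWalk.pathWeight_le (h : IsSimpleRandomWalk P x Z) (A : Finset (Lattice d))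
    (l : List (Lattice d)) :
    pathWeight (fun _ => 1) A (x :: l) ≤ P {ω | stoppedPath A (fun r => Z r ω) = x :: l} := by
  by_cases h0 : pathWeight (fun _ => 1) A (x :: l) = 0
  · rw [h0]; exact zero_le
  set g : ℕ → Lattice d := fun i => (x :: l).getD i 0
  calc pathWeight (fun _ => 1) A (x :: l)
      ≤ ∏ i ∈ Finset.range l.length, stepProb (g i) (g (i + 1)) := pathWeight_one_le A x l
    _ ≤ ∏ i ∈ Finset.range l.length, P {ω | Z (i + 1) ω - Z i ω = g (i + 1) - g i} :=
        Finset.prod_le_prod' fun i _ => h.stepProb_le i _ _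
    _ = P (⋂ i ∈ Finset.range l.length, {ω | Z (i + 1) ω - Z i ω = g (i + 1) - g i}) :=
        (h.indep.measure_inter_preimage_eq_mul (Finset.range l.length)
          (sets := fun i => {g (i + 1) - g i}) (fun i _ => MeasurableSet.singleton _)).symm
    _ ≤ P {ω | stoppedPath A (fun r => Z r ω) = x :: l} := by
        refine measure_mono_ae ?_
        filter_upwards [h.start] with ω hω hmem
        have hmem : ∀ i < l.length, Z (i + 1) ω - Z i ω = g (i + 1) - g i := by
          have := Set.mem_iInter₂.1 hmem
          intro i hi
          exact this i (Finset.mem_range.2 hi)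
        have key : ∀ i < l.length + 1, Z i ω = g i := by
          intro i
          induction i with
          | zero => intro _; simpa [g] using hω
          | succ i ih =>
            intro hi
            have h1 := hmem i (by omega)
            rw [ih (by omega)] at h1
            exact sub_left_injective h1
        exact stoppedPath_eq_of_pathWeight_ne_zero h0 (fun i hi => key i (by simpa using hi))

lemma IsSimpleRandomWalk.measurable_path (h : IsSimpleRandomWalk P x Z) :
    Measurable (fun ω r => Z r ω) := measurable_pi_lambda _ h.measurable

/-- Expectations of functions of the stopped walk are sums over stopped paths. -/
lemma IsSimpleRandomWalk.lintegral_stoppedPath [IsProbabilityMeasure P] (hd : 1 ≤ d)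
    (h : IsSimpleRandomWalk P x Z) (A : Finset (Lattice d)) (F : List (Lattice d) → ℝ≥0∞) :
    ∫⁻ ω, F (stoppedPath A (fun r => Z r ω)) ∂P = pathSum (fun _ => 1) A F x := by
  let : MeasurableSpace (List (Lattice d)) := ⊤
  have hY : Measurable (fun ω => stoppedPath A (fun r => Z r ω)) :=
    (measurable_stoppedPath A id).comp h.measurable_path
  have hF : Measurable F := fun _ _ => trivial
  let q : List (Lattice d) → ℝ≥0∞ := fun L =>
    if L.head? = some x then pathWeight (fun _ => 1) A L else 0
  let μ := P.map (fun ω => stoppedPath A (fun r => Z r ω))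
  have : IsProbabilityMeasure μ := Measure.isProbabilityMeasure_map hY.aemeasurable
  have hsum : ∀ G : List (Lattice d) → ℝ≥0∞,
      ∑' L, q L * G L = pathSum (fun _ => 1) A G x := by
    intro G
    rw [tsum_list_eq, tsum_eq_single x]
    · simp [q, pathSum]
    · intro b hb; simp [q, hb]
  have hq1 : ∑' L, q L = 1 := by
    have := hsum fun _ => 1
    simpa [pathSum_one hd] using this
  have hμ1 : ∑' L, μ {L} = 1 := by
    have h1 := lintegral_countable' (μ := μ) (fun _ => 1)
    simpa using h1.symm
  have hle : ∀ L, q L ≤ μ {L} := by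
    intro L
    simp only [q]
    split_ifs with hL
    · obtain ⟨l, rfl⟩ : ∃ l, L = x :: l := by
        cases L with
        | nil => simp at hL
        | cons a l => simp at hL; exact ⟨l, by rw [hL]⟩
      rw [Measure.map_apply hY (MeasurableSet.singleton _)]
      exact h.pathWeight_le A l
    · exact zero_le
  -- Termwise domination with equal finite total mass forces equality. This is where the almost sure
  -- exit from `A` (`pathSum_one`) enters.
  have hqμ : ∀ L, μ {L} = q L := by
    intro L
    by_contra hne
    have := ENNReal.tsum_lt_tsum (by rw [hq1]; exact ENNReal.one_ne_top) hle
      (lt_of_le_of_ne (hle L) (Ne.symm hne))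
    rw [hq1, hμ1] at this
    exact lt_irrefl _ this
  rw [← lintegral_map hF hY, lintegral_countable', ← hsum]
  exact tsum_congr fun L => by rw [hqμ, mul_comm]

/-- Stopped paths of weight zero have probability zero, and those of nonzero weight end outside of
`A`. This rules out the default value of `exitTime`. -/
lemma IsSimpleRandomWalk.ae_exit [IsProbabilityMeasure P] (hd : 1 ≤ d)
    (h : IsSimpleRandomWalk P x Z) (A : Finset (Lattice d)) :
    ∀ᵐ ω ∂P, Z (exitTime A (fun r => Z r ω)) ω ∉ A := by
  classical
  let F : List (Lattice d) → ℝ≥0∞ := fun l => if pathWeight (fun _ => 1) A l = 0 then 1 else 0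
  have h0 : ∫⁻ ω, F (stoppedPath A (fun r => Z r ω)) ∂P = 0 := by
    rw [h.lintegral_stoppedPath hd A F, pathSum, ENNReal.tsum_eq_zero]
    intro l
    simp only [F]
    split_ifs with h1 <;> simp [h1]
  rw [lintegral_eq_zero_iff (by exact (measurable_stoppedPath A F).comp h.measurable_path)] at h0
  filter_upwards [h0] with ω hω
  have hne : pathWeight (fun _ => 1) A (stoppedPath A (fun r => Z r ω)) ≠ 0 := by
    intro h1
    simp [F, h1] at hω
  obtain ⟨m, h1, -, h3⟩ := exists_length_of_pathWeight_ne_zero hne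
  rw [length_stoppedPath, add_left_inj] at h1
  rw [← h1, stoppedPath_getD _ _ le_rfl] at h3
  exact h3

/-- One step of Wilson's algorithm: the walk with a factor `(1 + κ)⁻¹` for every visit. -/
lemma IsSimpleRandomWalk.lintegral_prod_killWeight [IsProbabilityMeasure P] (hd : 1 ≤ d)
    (h : IsSimpleRandomWalk P x Z) {D : Finset (Lattice d)} {κ : Lattice d → ℝ}
    (hκ : ∀ y, 0 ≤ κ y) {A : Finset (Lattice d)} (hAD : A ⊆ D) :
    ∫⁻ ω, (∏ r ∈ Finset.range (exitTime A (fun r => Z r ω)), killWeight κ (Z r ω)) *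
      ENNReal.ofReal (detRatio D κ (A \ (loopErasure (stoppedPath A (fun r => Z r ω))).toFinset))
      ∂P = ENNReal.ofReal (detRatio D κ A) := by
  have h1 := h.lintegral_stoppedPath hd A (fun l => (l.dropLast.map (killWeight κ)).prod *
    ENNReal.ofReal (detRatio D κ (A \ (loopErasure l).toFinset)))
  simp only [prod_dropLast_stoppedPath] at h1
  rw [h1, ← pathSum_detRatio hd hκ hAD x]
  refine tsum_congr fun l => ?_
  rw [pathWeight_eq_mul_prod (killWeight κ)]
  ring

end Walk

end

section

/-! ### Iterating over the walks of the algorithm -/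

variable {d n : ℕ} {D : Finset (Lattice d)}

lemma explored_succ (z : Fin n → ℕ → Lattice d) {m : ℕ} (h : m < n) :
    explored D z (m + 1) = explored D z m ∪
      (loopErasure (stoppedPath (D \ explored D z m) (z ⟨m, h⟩))).toFinset := by
  rw [explored, dif_pos h]
  rfl

lemma explored_mono (z : Fin n → ℕ → Lattice d) : Monotone (explored D z) := by
  refine monotone_nat_of_le_succ fun m => ?_
  rw [explored]
  split_ifs
  · exact Finset.subset_union_left
  · exact le_rfl

/-- A loop-erasure keeps the first point of its path, even if the walk is stopped at once. Hence the
algorithm exhausts `D` when the walks start from all of its points. -/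
lemma start_mem_explored (z : Fin n → ℕ → Lattice d) (j : Fin n) : z j 0 ∈ explored D z n := by
  have h : z j 0 ∈ explored D z (j + 1) := by
    rw [explored_succ z j.2, stoppedPath, List.range_succ_eq_map, List.map_cons, loopErasure_cons]
    simp
  exact explored_mono z (Nat.succ_le_of_lt j.2) h

lemma measurable_apply_of_countable {α β S : Type*} [Countable S] {_ : MeasurableSpace α}
    [MeasurableSpace β] {X : α → S} (hX : ∀ s, MeasurableSet {a | X a = s}) {f : S → α → β}
    (hf : ∀ s, Measurable (f s)) : Measurable (fun a => f (X a) a) := by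
  intro t ht
  have : (fun a => f (X a) a) ⁻¹' t = ⋃ s, {a | X a = s} ∩ f s ⁻¹' t := by
    ext a; simp
  rw [this]
  exact MeasurableSet.iUnion fun s => (hX s).inter (hf s ht)

lemma measurable_apply_exitTime {E β : Type*} [MeasurableSpace E] [MeasurableSpace β]
    {f : ℕ → E → β} (hf : ∀ m, Measurable (f m)) (A : Finset (Lattice d)) {π : E → ℕ → Lattice d}
    (hπ : Measurable π) : Measurable (fun e => f (exitTime A (π e)) e) :=
  measurable_apply_of_countable
    (fun m => ((measurable_exitTime A).comp hπ) (MeasurableSet.singleton m)) hf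

section Iteration

variable {Ω E : Type*} {mΩ : MeasurableSpace Ω} [mE : MeasurableSpace E] {P : Measure Ω}
  {ξ : Fin n → Ω → E} {π : E → ℕ → Lattice d}

/-- The information contained in the first `m` of the variables `ξ`. -/
@[reducible] def prefixSigma (ξ : Fin n → Ω → E) (m : ℕ) : MeasurableSpace Ω :=
  ⨆ j ∈ {j : Fin n | (j : ℕ) < m}, mE.comap (ξ j)

lemma prefixSigma_mono (ξ : Fin n → Ω → E) {m m' : ℕ} (h : m ≤ m') :
    prefixSigma ξ m ≤ prefixSigma ξ m' :=
  biSup_mono fun _ hj => lt_of_lt_of_le hj h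

lemma prefixSigma_le (hξ : ∀ j, Measurable (ξ j)) (m : ℕ) : prefixSigma ξ m ≤ mΩ :=
  iSup₂_le fun j _ => (hξ j).comap_le

lemma measurable_prefixSigma (ξ : Fin n → Ω → E) {m : ℕ} {j : Fin n} (h : (j : ℕ) < m) :
    Measurable[prefixSigma ξ m] (ξ j) :=
  (comap_measurable (ξ j)).mono
    (le_iSup₂ (f := fun (j : Fin n) (_ : j ∈ {j : Fin n | (j : ℕ) < m}) => mE.comap (ξ j)) j h)
    le_rfl

/-- The explored set after `m` steps is a function of the first `m` variables, and thus independent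
of the walk used next. -/
lemma measurableSet_explored_eq (hπ : Measurable π) (m : ℕ) (hm : m ≤ n)
    (s : Finset (Lattice d)) :
    MeasurableSet[prefixSigma ξ m] {ω | explored D (fun j => π (ξ j ω)) m = s} := by
  induction m generalizing s with
  | zero =>
    by_cases hs : ∅ = s <;> simp [explored, hs]
  | succ m ih =>
    have hmn : m < n := hm
    have : {ω | explored D (fun j => π (ξ j ω)) (m + 1) = s} =
        ⋃ t : Finset (Lattice d), {ω | explored D (fun j => π (ξ j ω)) m = t} ∩
          (ξ ⟨m, hmn⟩) ⁻¹' {e | t ∪ (loopErasure (stoppedPath (D \ t) (π e))).toFinset = s} := by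
      ext ω
      simp [explored_succ _ hmn]
    rw [this]
    refine MeasurableSet.iUnion fun t => MeasurableSet.inter ?_ ?_
    · exact prefixSigma_mono ξ (Nat.le_succ m) _ (ih hmn.le t)
    · refine measurable_prefixSigma ξ (Nat.lt_succ_self m) ?_
      let : MeasurableSpace (Finset (Lattice d)) := ⊤
      exact ((measurable_stoppedPath (D \ t) fun l => t ∪ (loopErasure l).toFinset).comp hπ)
        (MeasurableSet.singleton s)

lemma tsum_ite_explored {f : Finset (Lattice d) → ℝ≥0∞} (X : Finset (Lattice d)) :
    f X = ∑' t, if X = t then f t else 0 := by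
  rw [tsum_eq_single X]
  · simp
  · intro t ht; simp [Ne.symm ht]

lemma measurable_explored_apply (hπ : Measurable π) {β : Type*} [MeasurableSpace β]
    {g : Finset (Lattice d) → E → β} (hg : ∀ s, Measurable (g s)) (j : Fin n) :
    Measurable[prefixSigma ξ (j + 1)]
      (fun ω => g (explored D (fun j => π (ξ j ω)) j) (ξ j ω)) :=
  measurable_apply_of_countable (f := fun s ω => g s (ξ j ω))
    (fun s => prefixSigma_mono ξ (Nat.le_succ _) _ (measurableSet_explored_eq hπ j j.2.le s))
    (fun s => (hg s).comp (measurable_prefixSigma ξ (Nat.lt_succ_self _)))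

/-- If the weights `g` of the single walks are such that `R` of the explored set is preserved in
mean by every step, then it is preserved in mean by the whole algorithm. -/
lemma lintegral_prod_explored (hξ : ∀ j, Measurable (ξ j)) (hind : iIndepFun ξ P)
    (hπ : Measurable π) {g : Finset (Lattice d) → E → ℝ≥0∞} (hg : ∀ s, Measurable (g s))
    (R : Finset (Lattice d) → ℝ≥0∞)
    (hstep : ∀ j s, ∫⁻ ω, g s (ξ j ω) *
      R (s ∪ (loopErasure (stoppedPath (D \ s) (π (ξ j ω)))).toFinset) ∂P = R s) :
    ∫⁻ ω, (∏ j : Fin n, g (explored D (fun j => π (ξ j ω)) j) (ξ j ω)) *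
      R (explored D (fun j => π (ξ j ω)) n) ∂P = R ∅ := by
  have hP : IsProbabilityMeasure P := hind.isProbabilityMeasure
  let X : ℕ → Ω → Finset (Lattice d) := fun m ω => explored D (fun j => π (ξ j ω)) m
  let Φ : ℕ → Ω → ℝ≥0∞ := fun m ω =>
    Finset.prod {j : Fin n | (j : ℕ) < m} fun j : Fin n => g (X j ω) (ξ j ω)
  have hΦ : ∀ m, Measurable[prefixSigma ξ m] (Φ m) := by
    intro m
    refine Finset.measurable_fun_prod _ fun j hj => ?_
    exact (measurable_explored_apply hπ hg j).mono
      (prefixSigma_mono ξ (by simpa using hj)) le_rfl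
  have key : ∀ m ≤ n, ∫⁻ ω, Φ m ω * R (X m ω) ∂P = R ∅ := by
    intro m
    induction m with
    | zero =>
      intro _
      simp [Φ, X, explored]
    | succ m ih =>
      intro hm
      have hmn : m < n := hm
      rw [← ih hmn.le]
      let G : Finset (Lattice d) → E → ℝ≥0∞ := fun t e =>
        g t e * R (t ∪ (loopErasure (stoppedPath (D \ t) (π e))).toFinset)
      have hG : ∀ t, Measurable (G t) := fun t =>
        (hg t).mul ((measurable_stoppedPath (D \ t)
          fun l => R (t ∪ (loopErasure l).toFinset)).comp hπ)
      have hI : ∀ t, Measurable[prefixSigma ξ m] (fun ω => if X m ω = t then Φ m ω else 0) :=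
        fun t => Measurable.ite (measurableSet_explored_eq hπ m hmn.le t) (hΦ m) measurable_const
      have hI' : ∀ t, Measurable (fun ω => if X m ω = t then Φ m ω else 0) := fun t =>
        (hI t).mono (prefixSigma_le hξ m) le_rfl
      have hfil : Finset.univ.filter (fun j : Fin n => (j : ℕ) < m + 1) =
          insert ⟨m, hmn⟩ (Finset.univ.filter (fun j : Fin n => (j : ℕ) < m)) := by
        ext j
        simp only [Finset.mem_filter, Finset.mem_univ, true_and, Finset.mem_insert, Fin.ext_iff]
        omega
      -- The explored set takes countably many values. Once it is frozen at `t`, the new step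
      -- contributes `G t`, a fixed function of the new walk alone.
      have e1 : ∀ ω, Φ (m + 1) ω * R (X (m + 1) ω) =
          ∑' t, (if X m ω = t then Φ m ω else 0) * G t (ξ ⟨m, hmn⟩ ω) := by
        intro ω
        have h1 : Φ (m + 1) ω = g (X m ω) (ξ ⟨m, hmn⟩ ω) * Φ m ω := by
          simp only [Φ]
          rw [hfil, Finset.prod_insert (by simp)]
        have h2 : X (m + 1) ω = X m ω ∪
            (loopErasure (stoppedPath (D \ X m ω) (π (ξ ⟨m, hmn⟩ ω)))).toFinset :=
          explored_succ _ hmn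
        have h3 := tsum_ite_explored (f := fun t => Φ m ω * G t (ξ ⟨m, hmn⟩ ω)) (X m ω)
        simp only [ite_mul, zero_mul]
        rw [← h3, h1, h2]
        simp only [G]
        ring
      have e2 : ∀ ω, Φ m ω * R (X m ω) = ∑' t, (if X m ω = t then Φ m ω else 0) * R t := by
        intro ω
        simp only [ite_mul, zero_mul]
        exact tsum_ite_explored (f := fun t => Φ m ω * R t) (X m ω)
      simp only [e1, e2]
      rw [lintegral_tsum fun t => by exact ((hI' t).mul ((hG t).comp (hξ _))).aemeasurable,
        lintegral_tsum fun t => by exact ((hI' t).mul measurable_const).aemeasurable]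
      refine tsum_congr fun t => ?_
      have hindep : Indep (prefixSigma ξ m) (mE.comap (ξ ⟨m, hmn⟩)) P := by
        have := indep_iSup_of_disjoint (fun j => (hξ j).comap_le) hind.iIndep
          (S := {j : Fin n | (j : ℕ) < m}) (T := {⟨m, hmn⟩}) (by simp)
        simpa [prefixSigma] using this
      -- Past and new walk factorise for each frozen `t`, and `hstep` evaluates the new factor to `R
      -- t`.
      rw [lintegral_mul_eq_lintegral_mul_lintegral_of_independent_measurableSpace
        (prefixSigma_le hξ m) (hξ ⟨m, hmn⟩).comap_le hindep (hI t)
        (by exact (hG t).comp (comap_measurable _)), hstep, lintegral_mul_const _ (hI' t)]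
  have := key n le_rfl
  simpa [Φ, X] using this

end Iteration

/-! ### The discrete-time occupation field -/

/-- A weight per visit can be collected site by site. -/
lemma prod_range_exitTime {M : Type*} [CommMonoid M] {A : Finset (Lattice d)} (hAD : A ⊆ D)
    (z : ℕ → Lattice d) (f : ℕ → M) :
    ∏ r ∈ Finset.range (exitTime A z), f r =
      ∏ y : D, ∏ r ∈ (Finset.range (exitTime A z)).filter (fun r => z r = y), f r := by
  rw [Finset.prod_coe_sort D
    (fun y => ∏ r ∈ (Finset.range (exitTime A z)).filter (fun r => z r = y), f r)]
  refine (Finset.prod_fiberwise_of_maps_to (fun r hr => ?_) f).symm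
  exact hAD (mem_of_lt_exitTime (Finset.mem_range.1 hr))

lemma prod_killWeight_eq_occupationV {κ : Lattice d → ℝ} (z : Fin n → ℕ → Lattice d) :
    ∏ j : Fin n, ∏ r ∈ Finset.range (exitTime (D \ explored D z j) (z j)), killWeight κ (z j r) =
      ∏ y : D, killWeight κ y ^ occupationV D z y := by
  simp only [occupationV, ← Finset.prod_pow_eq_pow_sum]
  rw [Finset.prod_comm (s := Finset.univ (α := D))]
  refine Finset.prod_congr rfl fun j _ => ?_
  rw [prod_range_exitTime (D := D) Finset.sdiff_subset]
  refine Finset.prod_congr rfl fun y _ => ?_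
  rw [← Finset.prod_const]
  refine Finset.prod_congr rfl fun r hr => ?_
  rw [(Finset.mem_filter.1 hr).2]

lemma sdiff_explored_eq_empty (x : Fin n ≃ D) {z : Fin n → ℕ → Lattice d}
    (h : ∀ j, z j 0 = x j) : D \ explored D z n = ∅ := by
  rw [Finset.sdiff_eq_empty_iff_subset]
  intro y hy
  have := start_mem_explored (D := D) z (x.symm ⟨y, hy⟩)
  simpa [h] using this

variable {κ : Lattice d → ℝ}

lemma measurable_prod_killWeight (κ : Lattice d → ℝ) (A : Finset (Lattice d)) :
    Measurable (fun z : ℕ → Lattice d =>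
      ∏ r ∈ Finset.range (exitTime A z), killWeight κ (z r)) :=
  measurable_apply_exitTime
    (f := fun m (z : ℕ → Lattice d) => ∏ r ∈ Finset.range m, killWeight κ (z r))
    (fun _ => Finset.measurable_fun_prod _ fun r _ =>
      (Measurable.of_discrete (f := killWeight κ)).comp (measurable_pi_apply r)) A measurable_id

lemma measurable_occupationV {Ω : Type*} [MeasurableSpace Ω] {Z : Fin n → ℕ → Ω → Lattice d}
    (hZ : ∀ j, Measurable (fun ω r => Z j r ω)) (y : D) :
    Measurable (fun ω => occupationV D (fun j r => Z j r ω) y) := by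
  refine Finset.measurable_fun_sum _ fun j _ => ?_
  refine (measurable_explored_apply (ξ := fun j ω r => Z j r ω) (π := id) measurable_id
    (g := fun s z => ((Finset.range (exitTime (D \ s) z)).filter fun r => z r = y).card)
    (fun s => ?_) j).mono (prefixSigma_le hZ _) le_rfl
  simp only [Finset.card_filter]
  refine measurable_apply_exitTime
    (f := fun m (z : ℕ → Lattice d) => ∑ r ∈ Finset.range m, if z r = y then 1 else 0)
    (fun m => Finset.measurable_fun_sum _ fun r _ => ?_) (D \ s) measurable_id
  exact (Measurable.of_discrete (f := fun a : Lattice d => if a = y then 1 else 0)).comp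
    (measurable_pi_apply r)

lemma lintegral_prod_killWeight_occupationV (hd : 1 ≤ d) (hκ : ∀ y, 0 ≤ κ y) (x : Fin n ≃ D)
    {Ω : Type*} [MeasurableSpace Ω] {P : Measure Ω} [IsProbabilityMeasure P]
    {Z : Fin n → ℕ → Ω → Lattice d}
    (hZ : ∀ j, IsSimpleRandomWalk P (x j : Lattice d) (Z j))
    (hindep : iIndepFun (fun (j : Fin n) (ω : Ω) (r : ℕ) => Z j r ω) P) :
    ∫⁻ ω, ∏ y : D, killWeight κ y ^ occupationV D (fun j r => Z j r ω) y ∂P =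
      ENNReal.ofReal (detRatio D κ D) := by
  have h := lintegral_prod_explored (D := D) (fun j => (hZ j).measurable_path) hindep
    (π := id) measurable_id
    (g := fun s z => ∏ r ∈ Finset.range (exitTime (D \ s) z), killWeight κ (z r))
    (fun s => measurable_prod_killWeight κ (D \ s))
    (fun s => ENNReal.ofReal (detRatio D κ (D \ s)))
    (fun j s => by
      have := (hZ j).lintegral_prod_killWeight hd hκ (D := D) (A := D \ s) Finset.sdiff_subset
      simpa only [id, sdiff_sdiff_left, Finset.sup_eq_union] using this)
  rw [Finset.sdiff_empty] at h
  rw [← h]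
  refine lintegral_congr_ae ?_
  filter_upwards [ae_all_iff.2 fun j => (hZ j).start] with ω hω
  simp only [id]
  -- At the end nothing of `D` is left, so the conserved quantity is 1 and only the product of
  -- weights remains.
  rw [sdiff_explored_eq_empty x hω, detRatio_empty, ENNReal.ofReal_one, mul_one,
    ← prod_killWeight_eq_occupationV]

end

section

/-! ### The continuous-time walk -/

section Path

variable {d : ℕ} {z : ℕ → Lattice d} {T : ℕ → ℝ}

lemma strictMono_sum_range (hT : ∀ r, 0 < T r) :
    StrictMono (fun m => ∑ i ∈ Finset.range m, T i) :=
  strictMono_nat_of_lt_succ fun m => by rw [Finset.sum_range_succ]; linarith [hT m]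

lemma ctPath_eq (hT : ∀ r, 0 < T r) {r : ℕ} {t : ℝ} (h1 : ∑ i ∈ Finset.range r, T i ≤ t)
    (h2 : t < ∑ i ∈ Finset.range (r + 1), T i) : ctPath z T t = z r := by
  have : sInf {m : ℕ | t < ∑ i ∈ Finset.range (m + 1), T i} = r := by
    refine le_antisymm (Nat.sInf_le h2) ?_
    by_contra hlt
    push Not at hlt
    have hne : {m : ℕ | t < ∑ i ∈ Finset.range (m + 1), T i}.Nonempty := ⟨r, h2⟩
    have h3 : t < _ := Nat.sInf_mem hne
    have h4 := (strictMono_sum_range hT).monotone (Nat.succ_le_of_lt hlt)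
    exact absurd (h3.trans_le h4) (not_lt.2 h1)
  rw [ctPath, this]

lemma exists_sum_range_le_lt {m : ℕ} {t : ℝ} (h0 : 0 ≤ t)
    (hm : t < ∑ i ∈ Finset.range m, T i) :
    ∃ r < m, ∑ i ∈ Finset.range r, T i ≤ t ∧ t < ∑ i ∈ Finset.range (r + 1), T i := by
  induction m with
  | zero => simp at hm; linarith
  | succ m ih =>
    by_cases h : t < ∑ i ∈ Finset.range m, T i
    · obtain ⟨r, hr, h'⟩ := ih h
      exact ⟨r, by omega, h'⟩
    · exact ⟨m, Nat.lt_succ_self m, not_lt.1 h, hm⟩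

/-- Before this sum the trajectory visits only sites of the skeleton preceding its exit. Positivity
of the holding times ensures that it is at the exit point at this very time, and `hz` excludes the
default value of `exitTime`. -/
lemma ctExitTime_eq {A : Finset (Lattice d)} (hT : ∀ r, 0 < T r) (hz : z (exitTime A z) ∉ A) :
    ctExitTime A (ctPath z T) = ∑ i ∈ Finset.range (exitTime A z), T i := by
  have hmem : (∑ i ∈ Finset.range (exitTime A z), T i) ∈
      {t | 0 ≤ t ∧ ctPath z T t ∉ A} := by
    refine ⟨Finset.sum_nonneg fun i _ => (hT i).le, ?_⟩
    rw [ctPath_eq hT le_rfl (strictMono_sum_range hT (Nat.lt_succ_self _))]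
    exact hz
  refine le_antisymm (csInf_le ⟨0, fun t ht => ht.1⟩ hmem) (le_csInf ⟨_, hmem⟩ ?_)
  rintro t ⟨ht0, ht⟩
  by_contra hlt
  push Not at hlt
  obtain ⟨r, hr, h1, h2⟩ := exists_sum_range_le_lt ht0 hlt
  rw [ctPath_eq hT h1 h2] at ht
  exact ht (mem_of_lt_exitTime hr)

/-- The time spent at `y` is a disjoint union of the half-open holding intervals of the visits to
`y`. -/
lemma volume_real_ctPath_eq {A : Finset (Lattice d)} (hT : ∀ r, 0 < T r)
    (hz : z (exitTime A z) ∉ A) (y : Lattice d) :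
    (volume : Measure ℝ).real {t | 0 ≤ t ∧ t < ctExitTime A (ctPath z T) ∧ ctPath z T t = y} =
      ∑ r ∈ (Finset.range (exitTime A z)).filter (fun r => z r = y), T r := by
  set S : ℕ → ℝ := fun m => ∑ i ∈ Finset.range m, T i with hS
  have hSm : Monotone S := (strictMono_sum_range hT).monotone
  have hset : {t | 0 ≤ t ∧ t < ctExitTime A (ctPath z T) ∧ ctPath z T t = y} =
      ⋃ r ∈ (Finset.range (exitTime A z)).filter (fun r => z r = y), Set.Ico (S r) (S (r + 1)) := by
    ext t
    simp only [Set.mem_ofPred_eq, Set.mem_iUnion, Finset.mem_filter, Finset.mem_range,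
      ctExitTime_eq hT hz, exists_prop, Set.mem_Ico]
    constructor
    · rintro ⟨h0, h1, h2⟩
      obtain ⟨r, hr, h3, h4⟩ := exists_sum_range_le_lt h0 h1
      rw [ctPath_eq hT h3 h4] at h2
      exact ⟨r, ⟨hr, h2⟩, h3, h4⟩
    · rintro ⟨r, ⟨hr, h2⟩, h3, h4⟩
      refine ⟨(Finset.sum_nonneg fun i _ => (hT i).le).trans h3, ?_, ?_⟩
      · exact h4.trans_le (hSm (Nat.succ_le_of_lt hr))
      · rw [ctPath_eq hT h3 h4, h2]
  rw [hset, measureReal_biUnion_finset (h := fun _ _ => by simp)]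
  · refine Finset.sum_congr rfl fun r _ => ?_
    rw [Real.volume_real_Ico_of_le (hSm (Nat.le_succ r))]
    simp [hS, Finset.sum_range_succ]
  · intro i _ j _ hij
    exact hSm.pairwise_disjoint_on_Ico_succ hij
  · exact fun _ _ => measurableSet_Ico

/-- The continuous-time occupation field as a sum of holding times. -/
lemma occupationW_eq {n : ℕ} {D : Finset (Lattice d)} {z : Fin n → ℕ → Lattice d}
    {T : Fin n → ℕ → ℝ} (hT : ∀ j r, 0 < T j r)
    (hz : ∀ j : Fin n, z j (exitTime (D \ explored D z j) (z j)) ∉ D \ explored D z j) (y : D) :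
    occupationW D z T y = ∑ j : Fin n,
      ∑ r ∈ (Finset.range (exitTime (D \ explored D z j) (z j))).filter (fun r => z j r = y),
        T j r :=
  Finset.sum_congr rfl fun j _ => volume_real_ctPath_eq (hT j) (hz j) y

end Path

/-- Tilting the exponential density of rate 1 by exp(-ct) gives (1+c)⁻¹ times the density of rate
1+c, which has mass 1. So a holding time reproduces the discrete killing weight. -/
lemma lintegral_exp_neg_mul_expMeasure {c : ℝ} (hc : 0 ≤ c) :
    ∫⁻ t, ENNReal.ofReal (Real.exp (-(c * t))) ∂(expMeasure 1) = ENNReal.ofReal (1 + c)⁻¹ := by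
  have h : expMeasure 1 = volume.withDensity (exponentialPDF 1) := rfl
  have hc' : 0 < 1 + c := by linarith
  have hmeas : ∀ r, Measurable (exponentialPDF r) := fun r =>
    (measurable_exponentialPDFReal r).ennreal_ofReal
  rw [h, lintegral_withDensity_eq_lintegral_mul _ (hmeas 1) (by fun_prop)]
  have : ∀ t, (exponentialPDF 1 * fun t => ENNReal.ofReal (Real.exp (-(c * t)))) t =
      ENNReal.ofReal (1 + c)⁻¹ * exponentialPDF (1 + c) t := by
    intro t
    rcases lt_or_ge t 0 with ht | ht
    · simp [exponentialPDF_of_neg ht]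
    · rw [Pi.mul_apply, exponentialPDF_of_nonneg ht, exponentialPDF_of_nonneg ht,
        ← ENNReal.ofReal_mul (by positivity), ← ENNReal.ofReal_mul (by positivity), one_mul, one_mul,
        ← Real.exp_add, ← mul_assoc, inv_mul_cancel₀ hc'.ne', one_mul]
      congr 2
      ring
  rw [lintegral_congr this, lintegral_const_mul _ (hmeas _), lintegral_exponentialPDF_eq_one hc',
    mul_one]

/-! ### Integrating out the exponential holding times -/

section Walk

variable {d : ℕ} {Ω : Type*} [MeasurableSpace Ω] {P : Measure Ω} {x : Lattice d}
  {Z : ℕ → Ω → Lattice d} {T : ℕ → Ω → ℝ}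

lemma IsCTSimpleRandomWalk.ae_pos (h : IsCTSimpleRandomWalk P x Z T) :
    ∀ᵐ ω ∂P, ∀ r, 0 < T r ω := by
  refine ae_all_iff.2 fun r => ?_
  have h0 : expMeasure 1 (Set.Iic 0) = 0 := by
    have h : expMeasure 1 = volume.withDensity (exponentialPDF 1) := rfl
    rw [h, withDensity_apply _ measurableSet_Iic, setLIntegral_congr Iio_ae_eq_Iic.symm]
    exact lintegral_exponentialPDF_of_nonpos le_rfl
  rw [← h.law r, Measure.map_apply (h.measurable r) measurableSet_Iic] at h0
  filter_upwards [measure_eq_zero_iff_ae_notMem.1 h0] with ω hω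
  simpa using hω

lemma IsCTSimpleRandomWalk.measurable_holding (h : IsCTSimpleRandomWalk P x Z T) :
    Measurable (fun ω r => T r ω) := measurable_pi_lambda _ h.measurable

lemma IsCTSimpleRandomWalk.lintegral_prod_exp (h : IsCTSimpleRandomWalk P x Z T) {c : ℕ → ℝ}
    (hc : ∀ r, 0 ≤ c r) (m : ℕ) :
    ∫⁻ t, ∏ r ∈ Finset.range m, ENNReal.ofReal (Real.exp (-(c r * t r)))
      ∂(P.map (fun ω r => T r ω)) = ∏ r ∈ Finset.range m, ENNReal.ofReal (1 + c r)⁻¹ := by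
  rw [lintegral_map (by fun_prop) h.measurable_holding]
  have hF : ∀ r, Measurable fun t : ℝ => ENNReal.ofReal (Real.exp (-(c r * t))) := fun r => by
    fun_prop
  rw [lintegral_prod_eq_prod_lintegral_of_indepFun (Finset.range m)
    (fun r ω => ENNReal.ofReal (Real.exp (-(c r * T r ω)))) (h.indep.comp _ hF)
    (fun r => (hF r).comp (h.measurable r))]
  refine Finset.prod_congr rfl fun r _ => ?_
  rw [← lintegral_exp_neg_mul_expMeasure (hc r), ← h.law r, lintegral_map (hF r) (h.measurable r)]

/-- The weight of a continuous-time walk with killing rate `κ`, as a function of the locations and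
the holding times. -/
noncomputable def ctWeight (κ : Lattice d → ℝ) (A : Finset (Lattice d))
    (e : (ℕ → Lattice d) × (ℕ → ℝ)) : ℝ≥0∞ :=
  ∏ r ∈ Finset.range (exitTime A e.1), ENNReal.ofReal (Real.exp (-(κ (e.1 r) * e.2 r)))

lemma measurable_ctWeight (κ : Lattice d → ℝ) (A : Finset (Lattice d)) :
    Measurable (ctWeight κ A) := by
  refine measurable_apply_exitTime (f := fun m (e : (ℕ → Lattice d) × (ℕ → ℝ)) =>
    ∏ r ∈ Finset.range m, ENNReal.ofReal (Real.exp (-(κ (e.1 r) * e.2 r)))) (fun m => ?_)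
    A measurable_fst
  refine Finset.measurable_fun_prod _ fun r _ => ?_
  have h1 : Measurable fun e : (ℕ → Lattice d) × (ℕ → ℝ) => κ (e.1 r) :=
    (Measurable.of_discrete (f := κ)).comp ((measurable_pi_apply r).comp measurable_fst)
  have h2 : Measurable fun e : (ℕ → Lattice d) × (ℕ → ℝ) => e.2 r :=
    (measurable_pi_apply r).comp measurable_snd
  exact ((h1.mul h2).neg.exp).ennreal_ofReal

/-- One step of Wilson's algorithm in continuous time. -/
lemma IsCTSimpleRandomWalk.lintegral_ctWeight [IsProbabilityMeasure P] (hd : 1 ≤ d)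
    (h : IsCTSimpleRandomWalk P x Z T) {D : Finset (Lattice d)} {κ : Lattice d → ℝ}
    (hκ : ∀ y, 0 ≤ κ y) {A : Finset (Lattice d)} (hAD : A ⊆ D) :
    ∫⁻ ω, ctWeight κ A ((fun r => Z r ω), fun r => T r ω) *
      ENNReal.ofReal (detRatio D κ (A \ (loopErasure (stoppedPath A (fun r => Z r ω))).toFinset))
      ∂P = ENNReal.ofReal (detRatio D κ A) := by
  have hZ := h.skeleton.measurable_path
  have hT := h.measurable_holding
  have hL := measurable_stoppedPath A
    fun l => ENNReal.ofReal (detRatio D κ (A \ (loopErasure l).toFinset))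
  have hF : Measurable fun e : (ℕ → Lattice d) × (ℕ → ℝ) => ctWeight κ A e *
      ENNReal.ofReal (detRatio D κ (A \ (loopErasure (stoppedPath A e.1)).toFinset)) :=
    (measurable_ctWeight κ A).mul (hL.comp measurable_fst)
  have hPT : IsProbabilityMeasure (P.map (fun ω r => T r ω)) :=
    Measure.isProbabilityMeasure_map hT.aemeasurable
  have hPZ : IsProbabilityMeasure (P.map (fun ω r => Z r ω)) :=
    Measure.isProbabilityMeasure_map hZ.aemeasurable
  have h1 := lintegral_map (μ := P) hF (hZ.prodMk hT)
  -- The skeleton determines the exit and the loop-erasure. With the skeleton fixed, the integral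
  -- over the holding times only replaces each exponential by `killWeight`.
  rw [← h1, (indepFun_iff_map_prod_eq_prod_map_map hZ.aemeasurable hT.aemeasurable).1
    h.indep_skeleton, lintegral_prod _ hF.aemeasurable]
  have h2 : ∀ z : ℕ → Lattice d, ∫⁻ t, ctWeight κ A (z, t) *
      ENNReal.ofReal (detRatio D κ (A \ (loopErasure (stoppedPath A z)).toFinset))
        ∂(P.map (fun ω r => T r ω)) =
      (∏ r ∈ Finset.range (exitTime A z), killWeight κ (z r)) *
        ENNReal.ofReal (detRatio D κ (A \ (loopErasure (stoppedPath A z)).toFinset)) := by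
    intro z
    rw [lintegral_mul_const _ (by exact (measurable_ctWeight κ A).comp measurable_prodMk_left)]
    congr 1
    exact h.lintegral_prod_exp (fun r => hκ (z r)) (exitTime A z)
  simp only [h2]
  rw [lintegral_map _ hZ]
  · exact h.skeleton.lintegral_prod_killWeight hd hκ hAD
  · exact (measurable_prod_killWeight κ A).mul hL

end Walk

/-! ### Laplace transform of the continuous-time occupation field -/

section Field

variable {d n : ℕ} {D : Finset (Lattice d)} {κ : Lattice d → ℝ}
  {Ω : Type*} [MeasurableSpace Ω] {P : Measure Ω}
  {Z : Fin n → ℕ → Ω → Lattice d} {T : Fin n → ℕ → Ω → ℝ}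

/-- The sum of the holding times at `y`. -/
noncomputable def holdingSum (D : Finset (Lattice d)) (z : Fin n → ℕ → Lattice d)
    (T : Fin n → ℕ → ℝ) (y : Lattice d) : ℝ :=
  ∑ j : Fin n,
    ∑ r ∈ (Finset.range (exitTime (D \ explored D z j) (z j))).filter (fun r => z j r = y), T j r

lemma measurable_walks (x : Fin n ≃ D)
    (hZ : ∀ j, IsCTSimpleRandomWalk P (x j : Lattice d) (Z j) (T j)) (j : Fin n) :
    Measurable (fun ω => ((fun r : ℕ => Z j r ω), (fun r : ℕ => T j r ω))) :=
  (hZ j).skeleton.measurable_path.prodMk (hZ j).measurable_holding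

lemma measurable_holdingSum (x : Fin n ≃ D)
    (hZ : ∀ j, IsCTSimpleRandomWalk P (x j : Lattice d) (Z j) (T j)) (y : Lattice d) :
    Measurable (fun ω => holdingSum D (fun j r => Z j r ω) (fun j r => T j r ω) y) := by
  refine Finset.measurable_fun_sum _ fun j _ => ?_
  refine (measurable_explored_apply (ξ := fun j ω => ((fun r : ℕ => Z j r ω), (fun r : ℕ => T j r ω)))
    (π := Prod.fst) measurable_fst
    (g := fun s (e : (ℕ → Lattice d) × (ℕ → ℝ)) =>
      ∑ r ∈ (Finset.range (exitTime (D \ s) e.1)).filter (fun r => e.1 r = y), e.2 r)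
    (fun s => ?_) j).mono (prefixSigma_le (measurable_walks x hZ) _) le_rfl
  simp only [Finset.sum_filter]
  refine measurable_apply_exitTime (f := fun m (e : (ℕ → Lattice d) × (ℕ → ℝ)) =>
    ∑ r ∈ Finset.range m, if e.1 r = y then e.2 r else 0)
    (fun m => Finset.measurable_fun_sum _ fun r _ => ?_) (D \ s) measurable_fst
  have hr : Measurable fun e : (ℕ → Lattice d) × (ℕ → ℝ) => e.1 r :=
    (measurable_pi_apply r).comp measurable_fst
  exact Measurable.ite (hr (MeasurableSet.singleton y))
    ((measurable_pi_apply r).comp measurable_snd) measurable_const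

variable [IsProbabilityMeasure P]

lemma ae_occupationW_eq (hd : 1 ≤ d) (x : Fin n ≃ D)
    (hZ : ∀ j, IsCTSimpleRandomWalk P (x j : Lattice d) (Z j) (T j)) :
    ∀ᵐ ω ∂P, (∀ j r, 0 < T j r ω) ∧
      ∀ y : D, occupationW D (fun j r => Z j r ω) (fun j r => T j r ω) y =
        holdingSum D (fun j r => Z j r ω) (fun j r => T j r ω) y := by
  -- There are countably many finite sets, so one null set serves all of them and the random set
  -- left by the earlier walks may be inserted.
  have hexit : ∀ᵐ ω ∂P, ∀ j, ∀ A : Finset (Lattice d),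
      Z j (exitTime A (fun r => Z j r ω)) ω ∉ A :=
    ae_all_iff.2 fun j => ae_all_iff.2 fun A => (hZ j).skeleton.ae_exit hd A
  filter_upwards [ae_all_iff.2 fun j => (hZ j).ae_pos, hexit] with ω h1 h2
  exact ⟨h1, fun y => occupationW_eq h1 (fun j => h2 j _) y⟩

lemma prod_ctWeight_eq_exp (z : Fin n → ℕ → Lattice d) (T : Fin n → ℕ → ℝ) :
    ∏ j : Fin n, ctWeight κ (D \ explored D z j) (z j, T j) =
      ENNReal.ofReal (Real.exp (-∑ y : D, κ y * holdingSum D z T y)) := by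
  have h : ∀ j : Fin n, ctWeight κ (D \ explored D z j) (z j, T j) = ENNReal.ofReal (Real.exp
      (∑ y : D, ∑ r ∈ (Finset.range (exitTime (D \ explored D z j) (z j))).filter
        (fun r => z j r = y), -(κ y * T j r))) := by
    intro j
    rw [ctWeight, prod_range_exitTime (D := D) Finset.sdiff_subset, Real.exp_sum,
      ENNReal.ofReal_prod_of_nonneg (fun _ _ => (Real.exp_pos _).le)]
    refine Finset.prod_congr rfl fun y _ => ?_
    rw [Real.exp_sum, ENNReal.ofReal_prod_of_nonneg (fun _ _ => (Real.exp_pos _).le)]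
    refine Finset.prod_congr rfl fun r hr => ?_
    rw [← (Finset.mem_filter.1 hr).2]
  simp only [h]
  rw [← ENNReal.ofReal_prod_of_nonneg (fun _ _ => (Real.exp_pos _).le), ← Real.exp_sum,
    Finset.sum_comm, ← Finset.sum_neg_distrib]
  congr 2
  refine Finset.sum_congr rfl fun y _ => ?_
  simp only [holdingSum, Finset.mul_sum, Finset.sum_neg_distrib]

lemma lintegral_exp_holdingSum (hd : 1 ≤ d) (hκ : ∀ y, 0 ≤ κ y) (x : Fin n ≃ D)
    (hZ : ∀ j, IsCTSimpleRandomWalk P (x j : Lattice d) (Z j) (T j))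
    (hindep : iIndepFun
      (fun (j : Fin n) (ω : Ω) => ((fun r : ℕ => Z j r ω), (fun r : ℕ => T j r ω))) P) :
    ∫⁻ ω, ENNReal.ofReal (Real.exp
      (-∑ y : D, κ y * holdingSum D (fun j r => Z j r ω) (fun j r => T j r ω) y)) ∂P =
      ENNReal.ofReal (detRatio D κ D) := by
  have h := lintegral_prod_explored (D := D) (measurable_walks x hZ) hindep
    (π := Prod.fst) measurable_fst
    (g := fun s => ctWeight κ (D \ s)) (fun s => measurable_ctWeight κ (D \ s))
    (fun s => ENNReal.ofReal (detRatio D κ (D \ s)))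
    (fun j s => by
      have := (hZ j).lintegral_ctWeight hd hκ (D := D) (A := D \ s) Finset.sdiff_subset
      simpa only [sdiff_sdiff_left, Finset.sup_eq_union] using this)
  rw [Finset.sdiff_empty] at h
  rw [← h]
  refine lintegral_congr_ae ?_
  filter_upwards [ae_all_iff.2 fun j => (hZ j).skeleton.start] with ω hω
  rw [sdiff_explored_eq_empty x hω, detRatio_empty, ENNReal.ofReal_one, mul_one,
    ← prod_ctWeight_eq_exp]

end Field

end

section

/-! ### Laplace transforms determine laws on the positive orthant -/

section Laplace

open scoped NNReal BoundedContinuousFunction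

variable {ι : Type*} [Fintype ι]

/-- The function `x ↦ exp (- ∑ i, k i * x i)` on the positive orthant. -/
noncomputable def expNeg (k : ι → ℝ≥0) : (ι → ℝ≥0) →ᵇ ℝ :=
  BoundedContinuousFunction.ofNormedAddCommGroup
    (fun x : ι → ℝ≥0 => Real.exp (-∑ i, (k i : ℝ) * x i)) (by fun_prop) 1 (fun x => by
      rw [Real.norm_of_nonneg (Real.exp_pos _).le, Real.exp_le_one_iff, neg_nonpos]
      exact Finset.sum_nonneg fun i _ => by positivity)

lemma expNeg_apply (k x : ι → ℝ≥0) : expNeg k x = Real.exp (-∑ i, (k i : ℝ) * x i) := rfl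

/-- The functions `expNeg k` form a monoid. -/
noncomputable def expNegHom : Multiplicative (ι → ℝ≥0) →* ((ι → ℝ≥0) →ᵇ ℝ) where
  toFun k := expNeg k.toAdd
  map_one' := by ext; simp [expNeg_apply]
  map_mul' k l := by
    ext
    simp [expNeg_apply, ← Real.exp_add, add_mul, Finset.sum_add_distrib]
    ring

/-- The exponentials are closed under products, so their linear span is an algebra of bounded
continuous functions; it separates points, hence determines finite measures. Working on the positive
orthant keeps the exponentials bounded. -/
lemma ext_of_laplace_nnreal {μ ν : Measure (ι → ℝ≥0)} [IsFiniteMeasure μ] [IsFiniteMeasure ν]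
    (h : ∀ k : ι → ℝ≥0, ∫ x, expNeg k x ∂μ = ∫ x, expNeg k x ∂ν) : μ = ν := by
  let A : StarSubalgebra ℝ ((ι → ℝ≥0) →ᵇ ℝ) :=
    { Algebra.adjoin ℝ (MonoidHom.mrange (expNegHom (ι := ι)) : Set ((ι → ℝ≥0) →ᵇ ℝ)) with
      star_mem' := fun {f} hf => by
        have : star f = f := by ext; simp
        rw [this]; exact hf }
  have hmem : ∀ k, expNeg k ∈ A := fun k => Algebra.subset_adjoin ⟨Multiplicative.ofAdd k, rfl⟩
  refine ext_of_forall_mem_subalgebra_integral_eq_of_pseudoEMetric_complete_countable (𝕜 := ℝ)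
    (A := A) ?_ fun g hg => ?_
  · intro x y hxy
    obtain ⟨i, hi⟩ := Function.ne_iff.1 hxy
    classical
    refine ⟨expNeg (Pi.single i 1), ⟨(expNeg (Pi.single i 1)).toContinuousMapStarₐ ℝ,
      ⟨_, hmem _, rfl⟩, rfl⟩, ?_⟩
    have hsum : ∀ u : ι → ℝ≥0, ∑ j, ((Pi.single i (1 : ℝ≥0) : ι → ℝ≥0) j : ℝ) * u j = u i := by
      intro u
      rw [Finset.sum_eq_single i]
      · simp
      · intro j _ hj; simp [hj]
      · simp
    change expNeg (Pi.single i 1) x ≠ expNeg (Pi.single i 1) y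
    rw [expNeg_apply, expNeg_apply, hsum, hsum]
    simpa using hi
  · have hg' : g ∈ Submodule.span ℝ
        (MonoidHom.mrange (expNegHom (ι := ι)) : Set ((ι → ℝ≥0) →ᵇ ℝ)) := by
      have h1 : g ∈ Subalgebra.toSubmodule (Algebra.adjoin ℝ
        (MonoidHom.mrange (expNegHom (ι := ι)) : Set ((ι → ℝ≥0) →ᵇ ℝ))) := hg
      rwa [Algebra.adjoin_eq_span, Submonoid.closure_eq] at h1
    clear hg
    induction hg' using Submodule.span_induction with
    | mem f hf =>
      obtain ⟨k, rfl⟩ := hf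
      exact h k.toAdd
    | zero => simp
    | add f g _ _ hf hg =>
      simp only [BoundedContinuousFunction.coe_add, Pi.add_apply]
      rw [integral_add (f.integrable μ) (g.integrable μ),
        integral_add (f.integrable ν) (g.integrable ν), hf, hg]
    | smul c f _ hf =>
      simp only [BoundedContinuousFunction.coe_smul]
      rw [integral_smul, integral_smul, hf]

lemma ext_of_laplace {μ ν : Measure (ι → ℝ)} [IsFiniteMeasure μ] [IsFiniteMeasure ν]
    (hμ : ∀ᵐ x ∂μ, ∀ i, 0 ≤ x i) (hν : ∀ᵐ x ∂ν, ∀ i, 0 ≤ x i)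
    (h : ∀ k : ι → ℝ, (∀ i, 0 ≤ k i) → ∫⁻ x, ENNReal.ofReal (Real.exp (-∑ i, k i * x i)) ∂μ =
      ∫⁻ x, ENNReal.ofReal (Real.exp (-∑ i, k i * x i)) ∂ν) : μ = ν := by
  let f : (ι → ℝ) → ι → ℝ≥0 := fun x i => (x i).toNNReal
  let g : (ι → ℝ≥0) → ι → ℝ := fun x i => x i
  have hf : Measurable f := by fun_prop
  have hg : Measurable g := by fun_prop
  have hgf : ∀ (ρ : Measure (ι → ℝ)), (∀ᵐ x ∂ρ, ∀ i, 0 ≤ x i) → (ρ.map f).map g = ρ := by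
    intro ρ hρ
    rw [Measure.map_map hg hf]
    have : g ∘ f =ᵐ[ρ] id := by
      filter_upwards [hρ] with x hx
      funext i
      exact Real.coe_toNNReal _ (hx i)
    rw [Measure.map_congr this, Measure.map_id]
  have hint : ∀ (ρ : Measure (ι → ℝ)), (∀ᵐ x ∂ρ, ∀ i, 0 ≤ x i) → ∀ k : ι → ℝ≥0,
      ∫ x, expNeg k x ∂(ρ.map f) =
        (∫⁻ x, ENNReal.ofReal (Real.exp (-∑ i, (k i : ℝ) * x i)) ∂ρ).toReal := by
    intro ρ hρ k
    have hm : Measurable fun x : ι → ℝ => expNeg k (f x) := (expNeg k).continuous.measurable.comp hf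
    rw [integral_map hf.aemeasurable (expNeg k).continuous.aestronglyMeasurable,
      integral_eq_lintegral_of_nonneg_ae (f := fun x => expNeg k (f x)) (Filter.Eventually.of_forall fun _ => (Real.exp_pos _).le)
        hm.aestronglyMeasurable]
    congr 1
    refine lintegral_congr_ae ?_
    filter_upwards [hρ] with x hx
    rw [expNeg_apply]
    simp [f, hx]
  rw [← hgf μ hμ, ← hgf ν hν]
  congr 1
  refine ext_of_laplace_nnreal fun k => ?_
  rw [hint μ hμ, hint ν hν, h (fun i => (k i : ℝ)) fun i => (k i).2]

end Laplace

/-! ### Gaussian integrals -/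

section Gaussian

variable {ι : Type*} [Fintype ι] [DecidableEq ι]

open scoped Matrix

/-- Factor `M = Bᵀ * B` and substitute `B γ`, with Jacobian |det B| = √(det M). The standard
Gaussian integral is left unevaluated because it will cancel. -/
lemma lintegral_exp_neg_quadratic {M : Matrix ι ι ℝ} (hM : M.PosSemidef) (hdet : M.det ≠ 0) :
    0 < M.det ∧ ENNReal.ofReal (Real.sqrt M.det) *
      ∫⁻ γ : ι → ℝ, ENNReal.ofReal (Real.exp (-(1 / 2) * (γ ⬝ᵥ (M *ᵥ γ)))) =
      ∫⁻ γ : ι → ℝ, ENNReal.ofReal (Real.exp (-(1 / 2) * (γ ⬝ᵥ γ))) := by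
  obtain ⟨B, rfl⟩ : ∃ B : Matrix ι ι ℝ, M = Bᵀ * B := by
    open scoped MatrixOrder in
    obtain ⟨B, hB⟩ := CStarAlgebra.nonneg_iff_eq_star_mul_self.1 hM.nonneg
    exact ⟨B, by rw [hB, Matrix.star_eq_conjTranspose, Matrix.conjTranspose_eq_transpose_of_trivial]⟩
  have hd : (Bᵀ * B).det = B.det ^ 2 := by rw [Matrix.det_mul, Matrix.det_transpose, sq]
  rw [hd] at hdet ⊢
  have hB : B.det ≠ 0 := fun h => hdet (by simp [h])
  refine ⟨by positivity, ?_⟩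
  have h1 : ∀ γ : ι → ℝ, γ ⬝ᵥ ((Bᵀ * B) *ᵥ γ) = (B.toLin' γ) ⬝ᵥ (B.toLin' γ) := by
    intro γ
    rw [Matrix.toLin'_apply, ← Matrix.mulVec_mulVec, Matrix.dotProduct_mulVec,
      Matrix.vecMul_transpose]
  have hf : Measurable fun γ : ι → ℝ => ENNReal.ofReal (Real.exp (-(1 / 2) * (γ ⬝ᵥ γ))) := by
    unfold dotProduct
    fun_prop
  have hB' : Measurable B.toLin' := (LinearMap.continuous_of_finiteDimensional _).measurable
  simp only [h1]
  rw [← lintegral_map hf hB', Real.map_matrix_volume_pi_eq_smul_volume_pi hB, lintegral_smul_measure,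
    smul_eq_mul, ← mul_assoc, Real.sqrt_sq_eq_abs, ← ENNReal.ofReal_mul (abs_nonneg _), ← abs_mul,
    mul_inv_cancel₀ hB, abs_one, ENNReal.ofReal_one, one_mul]

end Gaussian

/-! ### The Gaussian free field -/

section GFF

open scoped Matrix

variable {d : ℕ} {D : Finset (Lattice d)}

lemma sum_union_image_sub (e : Lattice d) {G : Lattice d → ℝ} (hG : ∀ y ∉ D, G y = 0) :
    ∑ x ∈ D ∪ D.image (fun y => y - e), G (x + e) = ∑ x ∈ D, G x := by
  rw [← Finset.sum_subset (Finset.subset_union_right (s₁ := D))]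
  · rw [Finset.sum_image (by intro a _ b _ h; exact sub_left_injective h)]
    simp
  · intro x _ hx
    refine hG _ fun h => hx (Finset.mem_image.2 ⟨_, h, by simp⟩)

/-- Discrete Green's formula: each squared edge difference is shared between its two end-points, and
terms at points outside of `D` vanish. -/
lemma dirichletEnergy_eq (hd : 1 ≤ d) (γ : D → ℝ) :
    dirichletEnergy D (extendZero D γ) / (2 * (d : ℝ)) = γ ⬝ᵥ ((-laplacianMatrix D) *ᵥ γ) := by
  set F := extendZero D γ with hF
  have hF0 : ∀ y ∉ D, F y = 0 := fun y hy => by simp [hF, extendZero, hy]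
  have hFD : ∀ y : D, F y = γ y := fun y => by simp [hF, extendZero]
  have h1 : ∀ i : Fin d, ∑ x ∈ D ∪ D.image (fun y => y - unitVec i), (F (x + unitVec i) - F x) ^ 2 =
      ∑ x ∈ D, F x * (2 * F x - (F (x + unitVec i) + F (x - unitVec i))) := by
    intro i
    have e1 : ∀ x, (F (x + unitVec i) - F x) ^ 2 =
        F (x + unitVec i) * (F (x + unitVec i) - F (x + unitVec i - unitVec i)) +
          F x * (F x - F (x + unitVec i)) := by
      intro x
      rw [add_sub_cancel_right]; ring
    simp only [e1, Finset.sum_add_distrib]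
    rw [sum_union_image_sub (unitVec i) (G := fun y => F y * (F y - F (y - unitVec i)))
      (fun y hy => by simp [hF0 y hy]),
      ← Finset.sum_subset (Finset.subset_union_left (s₁ := D)) (fun x _ hx => by simp [hF0 x hx]),
      ← Finset.sum_add_distrib]
    exact Finset.sum_congr rfl fun x _ => by ring
  have hd' : (d : ℝ) ≠ 0 := by positivity
  have h2 : ∀ y : D, ((-laplacianMatrix D) *ᵥ γ) y = F y - (2 * (d : ℝ))⁻¹ * ∑ i : Fin d,
      (F (y + unitVec i) + F (y - unitVec i)) := by
    intro y
    have := mulVec_laplacianMatrix_add (κ := 0) γ y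
    simpa [hFD] using this
  simp only [dirichletEnergy, h1]
  rw [Finset.sum_comm, dotProduct]
  simp only [h2, ← hFD]
  rw [Finset.sum_coe_sort D (fun y => F y * (F y - (2 * (d : ℝ))⁻¹ * ∑ i : Fin d,
      (F (y + unitVec i) + F (y - unitVec i)))), Finset.sum_div]
  refine Finset.sum_congr rfl fun y _ => ?_
  rw [← Finset.mul_sum, Finset.sum_sub_distrib]
  simp only [Finset.sum_const, Finset.card_univ, Fintype.card_fin, nsmul_eq_mul]
  field_simp

lemma laplacianMatrix_apply (x y : D) :
    laplacianMatrix D x y = (2 * (d : ℝ))⁻¹ * ∑ i : Fin d,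
      ((if (x : Lattice d) + unitVec i = y then 1 else 0) +
        if (x : Lattice d) - unitVec i = y then 1 else 0) - if x = y then 1 else 0 := by
  have hext : ∀ z : Lattice d, extendZero D (Pi.single y 1) z = if z = y then 1 else 0 := by
    intro z
    unfold extendZero
    split_ifs with h1 h2 h2
    · subst h2; simp
    · rw [Pi.single_eq_of_ne]
      rintro rfl; exact h2 rfl
    · subst h2; exact absurd y.2 h1
    · rfl
  rw [laplacianMatrix, LinearMap.toMatrix'_apply]
  simp only [dirichletLaplacian, LinearMap.coe_mk, AddHom.coe_mk, laplacian]
  simp only [hext, Subtype.ext_iff]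

lemma laplacianMatrix_transpose : (laplacianMatrix D)ᵀ = laplacianMatrix D := by
  ext x y
  rw [Matrix.transpose_apply, laplacianMatrix_apply, laplacianMatrix_apply]
  congr 1
  · congr 1
    refine Finset.sum_congr rfl fun i _ => ?_
    rw [add_comm]
    congr 1
    · exact if_congr (by rw [sub_eq_iff_eq_add, eq_comm]) rfl rfl
    · exact if_congr (by rw [← eq_sub_iff_add_eq, eq_comm]) rfl rfl
  · exact if_congr eq_comm rfl rfl

lemma dotProduct_killedMatrix (hd : 1 ≤ d) (κ : Lattice d → ℝ) (γ : D → ℝ) :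
    γ ⬝ᵥ (killedMatrix D κ D *ᵥ γ) =
      dirichletEnergy D (extendZero D γ) / (2 * (d : ℝ)) + ∑ y : D, κ y * γ y ^ 2 := by
  rw [killedMatrix_self, Matrix.add_mulVec, dotProduct_add, dirichletEnergy_eq hd]
  congr 1
  rw [dotProduct]
  refine Finset.sum_congr rfl fun y _ => ?_
  rw [Matrix.mulVec_diagonal]
  ring

lemma posSemidef_killedMatrix (hd : 1 ≤ d) {κ : Lattice d → ℝ} (hκ : ∀ y, 0 ≤ κ y) :
    (killedMatrix D κ D).PosSemidef := by
  refine Matrix.PosSemidef.of_dotProduct_mulVec_nonneg ?_ fun γ => ?_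
  · rw [Matrix.IsHermitian, Matrix.conjTranspose_eq_transpose_of_trivial, killedMatrix_self,
      Matrix.transpose_add, Matrix.transpose_neg, laplacianMatrix_transpose,
      Matrix.diagonal_transpose]
  · rw [star_trivial, dotProduct_killedMatrix hd]
    have h1 : 0 ≤ dirichletEnergy D (extendZero D γ) :=
      Finset.sum_nonneg fun i _ => Finset.sum_nonneg fun x _ => sq_nonneg _
    have h2 : 0 ≤ ∑ y : D, κ y * γ y ^ 2 :=
      Finset.sum_nonneg fun y _ => mul_nonneg (hκ y) (sq_nonneg _)
    positivity

variable {Ω : Type*} [MeasurableSpace Ω] {P : Measure Ω} [IsProbabilityMeasure P]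
  {Γ Γ' : Ω → D → ℝ} {κ : Lattice d → ℝ}

/-- The left side equals the same product `c * C` for every killing rate. For rate 0 the expectation
is 1, which eliminates the unknown normalising constant. -/
lemma IsGFF.lintegral_exp_mul_sqrt_det (hd : 1 ≤ d) (h : IsGFF P D Γ) (hκ : ∀ y, 0 ≤ κ y) :
    (∫⁻ ω, ENNReal.ofReal (Real.exp (-∑ y : D, κ y * (Γ ω y ^ 2 / 2))) ∂P) *
      ENNReal.ofReal (Real.sqrt (killedMatrix D κ D).det) =
    ENNReal.ofReal (Real.sqrt (killedMatrix D 0 D).det) := by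
  obtain ⟨c, hc⟩ := h.density
  set C := ∫⁻ γ : D → ℝ, ENNReal.ofReal (Real.exp (-(1 / 2) * (γ ⬝ᵥ γ))) with hC
  have key : ∀ κ : Lattice d → ℝ, (∀ y, 0 ≤ κ y) →
      (∫⁻ ω, ENNReal.ofReal (Real.exp (-∑ y : D, κ y * (Γ ω y ^ 2 / 2))) ∂P) *
        ENNReal.ofReal (Real.sqrt (killedMatrix D κ D).det) = c * C := by
    intro κ hκ
    have hF : Measurable fun γ : D → ℝ =>
        ENNReal.ofReal (Real.exp (-∑ y : D, κ y * (γ y ^ 2 / 2))) := by fun_prop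
    have hq : ∀ κ : Lattice d → ℝ, Measurable fun γ : D → ℝ =>
        γ ⬝ᵥ (killedMatrix D κ D *ᵥ γ) := by
      intro κ
      unfold dotProduct Matrix.mulVec dotProduct
      fun_prop
    have hG : ∀ γ : D → ℝ, Real.exp (-(1 / 2) *
        (dirichletEnergy D (extendZero D γ) / (2 * (d : ℝ)))) =
        Real.exp (-(1 / 2) * (γ ⬝ᵥ (killedMatrix D 0 D *ᵥ γ))) := by
      intro γ
      rw [dotProduct_killedMatrix hd]
      simp
    simp only [hG] at hc
    have hG' : Measurable fun γ : D → ℝ =>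
        ENNReal.ofReal (Real.exp (-(1 / 2) * (γ ⬝ᵥ (killedMatrix D 0 D *ᵥ γ)))) :=
      ((hq 0).const_mul _).exp.ennreal_ofReal
    have hk' : Measurable fun γ : D → ℝ =>
        ENNReal.ofReal (Real.exp (-(1 / 2) * (γ ⬝ᵥ (killedMatrix D κ D *ᵥ γ)))) :=
      ((hq κ).const_mul _).exp.ennreal_ofReal
    rw [← lintegral_map' (μ := P) hF.aemeasurable h.aemeasurable, hc,
      lintegral_withDensity_eq_lintegral_mul _ (hG'.const_mul c) hF]
    have e1 : ∀ γ : D → ℝ, ((fun γ : D → ℝ => c *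
        ENNReal.ofReal (Real.exp (-(1 / 2) * (γ ⬝ᵥ (killedMatrix D 0 D *ᵥ γ))))) *
        fun γ : D → ℝ => ENNReal.ofReal (Real.exp (-∑ y : D, κ y * (γ y ^ 2 / 2)))) γ =
        c * ENNReal.ofReal (Real.exp (-(1 / 2) * (γ ⬝ᵥ (killedMatrix D κ D *ᵥ γ)))) := by
      intro γ
      rw [Pi.mul_apply, mul_assoc, ← ENNReal.ofReal_mul (Real.exp_pos _).le, ← Real.exp_add,
        dotProduct_killedMatrix hd, dotProduct_killedMatrix hd]
      congr 3
      simp only [Pi.zero_apply, zero_mul, Finset.sum_const_zero, add_zero, mul_add, Finset.mul_sum,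
        ← Finset.sum_neg_distrib]
      congr 1
      exact Finset.sum_congr rfl fun y _ => by ring
    rw [lintegral_congr e1, lintegral_const_mul _ hk', mul_assoc, mul_comm (∫⁻ _, _)]
    rw [(lintegral_exp_neg_quadratic (posSemidef_killedMatrix hd hκ)
      (det_killedMatrix_ne_zero hd hκ D)).2]
  rw [key κ hκ, ← key 0 fun _ => le_rfl]
  simp

/-- The Laplace transform of half the sum of the squares of two independent fields. -/
lemma IsGFF.lintegral_exp_sq_add_sq (hd : 1 ≤ d) (h : IsGFF P D Γ) (h' : IsGFF P D Γ')
    (hind : IndepFun Γ Γ' P) (hκ : ∀ y, 0 ≤ κ y) :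
    ∫⁻ ω, ENNReal.ofReal (Real.exp
      (-∑ y : D, κ y * (Γ ω y ^ 2 / 2 + Γ' ω y ^ 2 / 2))) ∂P =
      ENNReal.ofReal (detRatio D κ D) := by
  let F : (D → ℝ) → ℝ≥0∞ := fun γ => ENNReal.ofReal (Real.exp (-∑ y : D, κ y * (γ y ^ 2 / 2)))
  have hF : Measurable F := by fun_prop
  have h1 : ∀ ω, ENNReal.ofReal (Real.exp
      (-∑ y : D, κ y * (Γ ω y ^ 2 / 2 + Γ' ω y ^ 2 / 2))) = F (Γ ω) * F (Γ' ω) := by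
    intro ω
    simp only [F]
    rw [← ENNReal.ofReal_mul (Real.exp_pos _).le, ← Real.exp_add]
    congr 2
    simp only [mul_add, Finset.sum_add_distrib]
    ring
  simp only [h1]
  have h2 := lintegral_mul_eq_lintegral_mul_lintegral_of_indepFun''
    (hF.comp_aemeasurable h.aemeasurable) (hF.comp_aemeasurable h'.aemeasurable)
    (hind.comp hF hF)
  simp only [Function.comp_apply] at h2
  rw [h2]
  have hk := (lintegral_exp_neg_quadratic (posSemidef_killedMatrix (D := D) hd hκ)
    (det_killedMatrix_ne_zero hd hκ D)).1
  have h0 := (lintegral_exp_neg_quadratic (posSemidef_killedMatrix (D := D) (κ := 0) hd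
    fun _ => le_rfl) (det_killedMatrix_ne_zero hd (fun _ => le_rfl) D)).1
  have e1 := h.lintegral_exp_mul_sqrt_det hd hκ
  have e2 := h'.lintegral_exp_mul_sqrt_det hd hκ
  have hs : ENNReal.ofReal (Real.sqrt (killedMatrix D κ D).det) ≠ 0 := by
    simpa using hk
  have hkpos : 0 < Real.sqrt (killedMatrix D κ D).det := Real.sqrt_pos.2 hk
  rw [mul_comm, ← ENNReal.eq_div_iff hs ENNReal.ofReal_ne_top,
    ← ENNReal.ofReal_div_of_pos hkpos] at e1 e2
  simp only [F]
  -- Each field gives the square root of the ratio; having exactly two fields removes the roots.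
  rw [e1, e2, ← ENNReal.ofReal_mul (by positivity), div_mul_div_comm, Real.mul_self_sqrt h0.le,
    Real.mul_self_sqrt hk.le, detRatio]

end GFF

end

/-! ### From killing rates on the lattice to functions on `D`, and conclusion -/

variable {d : ℕ} {D : Finset (Lattice d)}

lemma extendZero_nonneg {k : D → ℝ} (hk : ∀ y, 0 ≤ k y) (y : Lattice d) :
    0 ≤ extendZero D k y := by
  unfold extendZero
  split_ifs
  · exact hk _
  · exact le_rfl

lemma extendZero_coe (k : D → ℝ) (y : D) : extendZero D k y = k y := by
  simp [extendZero]

lemma detRatio_extendZero (k : D → ℝ) :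
    detRatio D (extendZero D k) D =
      (-laplacianMatrix D).det / (-laplacianMatrix D + Matrix.diagonal k).det := by
  rw [detRatio, killedMatrix_self, killedMatrix_self]
  simp only [extendZero_coe, Pi.zero_apply, Matrix.diagonal_zero, add_zero]

lemma prod_killWeight_extendZero {k : D → ℝ} (hk : ∀ y, 0 ≤ k y) (v : D → ℕ) :
    ∏ y : D, killWeight (extendZero D k) y ^ v y =
      ENNReal.ofReal (∏ y : D, (1 + k y) ^ (-(v y : ℤ))) := by
  have h0 : ∀ y, 0 ≤ (1 + k y)⁻¹ := fun y => inv_nonneg.2 (by linarith [hk y])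
  rw [ENNReal.ofReal_prod_of_nonneg fun y _ => zpow_nonneg (by linarith [hk y]) _]
  refine Finset.prod_congr rfl fun y _ => ?_
  rw [killWeight, extendZero_coe, ← ENNReal.ofReal_pow (h0 y), zpow_neg, zpow_natCast, inv_pow]

end Wilson

theorem mainTheorem4
    {d : ℕ} (hd : 1 ≤ d) (D : Finset (Wilson.Lattice d)) {n : ℕ} (x : Fin n ≃ D)
    -- the walks of the discrete-time algorithm
    {Ω₁ : Type*} [MeasurableSpace Ω₁] (P₁ : Measure Ω₁) [IsProbabilityMeasure P₁]
    (Z₁ : Fin n → ℕ → Ω₁ → Wilson.Lattice d)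
    (hZ₁ : ∀ j, Wilson.IsSimpleRandomWalk P₁ (x j : Wilson.Lattice d) (Z₁ j))
    (hindep₁ : iIndepFun (fun (j : Fin n) (ω : Ω₁) (r : ℕ) => Z₁ j r ω) P₁)
    -- the walks of the continuous-time algorithm
    {Ω₂ : Type*} [MeasurableSpace Ω₂] (P₂ : Measure Ω₂) [IsProbabilityMeasure P₂]
    (Z₂ : Fin n → ℕ → Ω₂ → Wilson.Lattice d) (T : Fin n → ℕ → Ω₂ → ℝ)
    (hZ₂ : ∀ j, Wilson.IsCTSimpleRandomWalk P₂ (x j : Wilson.Lattice d) (Z₂ j) (T j))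
    (hindep₂ : iIndepFun
      (fun (j : Fin n) (ω : Ω₂) => ((fun r : ℕ => Z₂ j r ω), (fun r : ℕ => T j r ω))) P₂)
    -- the two occupation fields
    (V : Ω₁ → D → ℕ) (hV : V = fun ω => Wilson.occupationV D (fun j r => Z₁ j r ω))
    (W : Ω₂ → D → ℝ)
    (hW : W = fun ω => Wilson.occupationW D (fun j r => Z₂ j r ω) (fun j r => T j r ω)) :
    (∀ k : D → ℝ, (∀ y, 0 ≤ k y) →
      ∫ ω, ∏ y : D, (1 + k y) ^ (-(V ω y : ℤ)) ∂P₁ =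
          ∫ ω, Real.exp (-∑ y : D, k y * W ω y) ∂P₂ ∧
      ∫ ω, Real.exp (-∑ y : D, k y * W ω y) ∂P₂ =
        (-Wilson.laplacianMatrix D).det / (-Wilson.laplacianMatrix D + Matrix.diagonal k).det) ∧
    -- two independent Gaussian free fields
    (∀ (Ω₃ : Type*) [MeasurableSpace Ω₃] (P₃ : Measure Ω₃) [IsProbabilityMeasure P₃]
      (Γ₁ Γ₂ : Ω₃ → D → ℝ), Wilson.IsGFF P₃ D Γ₁ → Wilson.IsGFF P₃ D Γ₂ → IndepFun Γ₁ Γ₂ P₃ →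
      IdentDistrib (fun ω y => Γ₁ ω y ^ 2 / 2 + Γ₂ ω y ^ 2 / 2) W P₃ P₂) := by
  subst hV hW
  have hae := Wilson.ae_occupationW_eq hd x hZ₂
  have hlap : ∀ k : D → ℝ, (∀ y, 0 ≤ k y) → ∫⁻ ω, ENNReal.ofReal (Real.exp (-∑ y : D, k y *
      Wilson.occupationW D (fun j r => Z₂ j r ω) (fun j r => T j r ω) y)) ∂P₂ =
      ENNReal.ofReal (Wilson.detRatio D (Wilson.extendZero D k) D) := by
    intro k hk
    rw [← Wilson.lintegral_exp_holdingSum hd (Wilson.extendZero_nonneg hk) x hZ₂ hindep₂]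
    refine lintegral_congr_ae ?_
    filter_upwards [hae] with ω hω
    simp only [Wilson.extendZero_coe, hω.2]
  -- `holdingSum` is a measurable version of the occupation field, with which it agrees almost
  -- surely.
  have hWm : AEMeasurable (fun ω => Wilson.occupationW D (fun j r => Z₂ j r ω)
      (fun j r => T j r ω)) P₂ := by
    refine ⟨fun ω y => Wilson.holdingSum D (fun j r => Z₂ j r ω) (fun j r => T j r ω) y,
      measurable_pi_lambda _ fun y => Wilson.measurable_holdingSum x hZ₂ y, ?_⟩
    filter_upwards [hae] with ω hω
    exact funext hω.2
  refine ⟨fun k hk => ?_, ?_⟩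
  · have hpos := Wilson.detRatio_pos hd (Wilson.extendZero_nonneg hk) (Finset.Subset.refl D)
    have h2 : ∫ ω, Real.exp (-∑ y : D, k y *
        Wilson.occupationW D (fun j r => Z₂ j r ω) (fun j r => T j r ω) y) ∂P₂ =
        Wilson.detRatio D (Wilson.extendZero D k) D := by
      rw [integral_eq_lintegral_of_nonneg_ae
        (Filter.Eventually.of_forall fun _ => (Real.exp_pos _).le), hlap k hk,
        ENNReal.toReal_ofReal hpos.le]
      have hg : Measurable fun v : D → ℝ => Real.exp (-∑ y : D, k y * v y) := by fun_prop
      exact (hg.comp_aemeasurable hWm).aestronglyMeasurable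
    have h1 : ∫ ω, ∏ y : D,
        (1 + k y) ^ (-(Wilson.occupationV D (fun j r => Z₁ j r ω) y : ℤ)) ∂P₁ =
        Wilson.detRatio D (Wilson.extendZero D k) D := by
      rw [integral_eq_lintegral_of_nonneg_ae (Filter.Eventually.of_forall fun _ =>
        Finset.prod_nonneg fun y _ => zpow_nonneg (by linarith [hk y]) _)]
      · simp only [← Wilson.prod_killWeight_extendZero hk]
        rw [Wilson.lintegral_prod_killWeight_occupationV hd (Wilson.extendZero_nonneg hk) x hZ₁
          hindep₁, ENNReal.toReal_ofReal hpos.le]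
      · refine Measurable.aestronglyMeasurable (Finset.measurable_fun_prod _ fun y _ => ?_)
        exact (Measurable.of_discrete (f := fun m : ℕ => (1 + k y) ^ (-(m : ℤ)))).comp
          (Wilson.measurable_occupationV (fun j => (hZ₁ j).measurable_path) y)
    exact ⟨h1.trans h2.symm, h2.trans (Wilson.detRatio_extendZero k)⟩
  · intro Ω₃ _ P₃ _ Γ₁ Γ₂ hΓ₁ hΓ₂ hind
    have hsq : Measurable fun p : (D → ℝ) × (D → ℝ) => fun y => p.1 y ^ 2 / 2 + p.2 y ^ 2 / 2 := by
      fun_prop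
    have hS : AEMeasurable (fun ω y => Γ₁ ω y ^ 2 / 2 + Γ₂ ω y ^ 2 / 2) P₃ :=
      hsq.comp_aemeasurable (hΓ₁.aemeasurable.prodMk hΓ₂.aemeasurable)
    have hnn : MeasurableSet {v : D → ℝ | ∀ y, 0 ≤ v y} := by
      measurability
    refine ⟨hS, hWm, ?_⟩
    have := Measure.isProbabilityMeasure_map hS
    have := Measure.isProbabilityMeasure_map hWm
    refine Wilson.ext_of_laplace ?_ ?_ fun k hk => ?_
    · rw [ae_map_iff hS hnn]
      exact Filter.Eventually.of_forall fun ω y => by positivity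
    · rw [ae_map_iff hWm hnn]
      exact Filter.Eventually.of_forall fun ω y =>
        Finset.sum_nonneg fun _ _ => measureReal_nonneg
    · have hg : Measurable fun v : D → ℝ => ENNReal.ofReal (Real.exp (-∑ y : D, k y * v y)) := by
        fun_prop
      rw [lintegral_map' hg.aemeasurable hS, lintegral_map' hg.aemeasurable hWm, hlap k hk,
        ← hΓ₁.lintegral_exp_sq_add_sq hd hΓ₂ hind (Wilson.extendZero_nonneg hk)]
      simp only [Wilson.extendZero_coe]
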